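/- Let $p$ be a prime, $n\ge 1$, and let $k$ be a nonzero perfect $\mathbb{F}_p$-algebra (a commutative ring of characteristic $p$ whose Frobenius $a\mapsto a^p$ is bijective). Let $W_n(-)$ denote $p$-typical Witt vectors of length $n$ and let $\Phi\colon W_n(k)\to W_n(k)$ be the Witt vector Frobenius. Let $X$ be a smooth $k$-scheme and let $X'$ be a smooth $W_n(k)$-scheme lifting $X$, i.e. given with an isomorphism $X\cong X'\times_{\mathrm{Spec}\,W_n(k)}\mathrm{Spec}\,k$, the base change being along the projection $W_n(k)\to k$, $(a_1,\dots,a_n)\mapsto a_1$. Then the resulting map $X\to X'$ is a homeomorphism, by which we regard the sheaf $W_n\mathcal{O}_X\colon U\mapsto W_n(\mathcal{O}_X(U))$ as a sheaf of rings on $X'$, and the following holds. There is exactly one morphism of sheaves of sets $$\tilde F^n\colon W_n\mathcal{O}_X\to\mathcal{O}_{X'},\qquad (x_1,\dots,x_n)\mapsto\sum_{i=0}^{n-1}p^i\,\tilde x_{i+1}^{\,p^{n-i}},$$ given by this formula whenever $\tilde x_1,\dots,\tilde x_n\in\mathcal{O}_{X'}(U)$ lift the sections $x_1,\dots,x_n$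 over an open set $U$ (such lifts exist locally, and the value does not depend on their choice). It is an injective morphism of sheaves of rings, it is $\Phi^n$-semilinear, i.e. $\tilde F^n(a\cdot x)=\Phi^n(a)\,\tilde F^n(x)$ for all $a\in W_n(k)$ and all sections $x$, and it induces an isomorphism of $W_n\mathcal{O}_X$ onto the kernel of the de Rham differential $d\colon\mathcal{O}_{X'}\to\Omega^1_{X'/W_n(k)}$; that is, over every open set it is a bijection onto the sections killed by $d$. -/

import Mathlib

open CategoryTheory AlgebraicGeometry TopologicalSpace Opposite

universe u

noncomputable section

namespace TruncatedWittVector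

variable {p : ℕ} [Fact p.Prime] {n : ℕ} {R S T : Type*} [CommRing R] [CommRing S] [CommRing T]

/-- Functoriality of truncated Witt vectors: `W_n(f)` applies `f` to every component. -/
def map (f : R →+* S) : TruncatedWittVector p n R →+* TruncatedWittVector p n S where
  toFun x := mk p fun i => f (x.coeff i)
  map_one' := by
    ext i
    have h : (1 : TruncatedWittVector p n R) = WittVector.truncate n 1 := (map_one _).symm
    have h' : (1 : TruncatedWittVector p n S) = WittVector.truncate n (WittVector.map f 1) := by
      rw [map_one, map_one]
    rw [h, h', coeff_mk, WittVector.coeff_truncate, WittVector.coeff_truncate, WittVector.map_coeff]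
  map_zero' := by
    ext i
    rw [coeff_mk, coeff_zero, coeff_zero, map_zero]
  map_mul' x y := by
    obtain ⟨x, rfl⟩ := WittVector.truncate_surjective p n R x
    obtain ⟨y, rfl⟩ := WittVector.truncate_surjective p n R y
    have h : ∀ z : WittVector p R, (mk p fun i => f ((WittVector.truncate n z).coeff i)) =
        WittVector.truncate n (WittVector.map f z) := fun z => by
      ext i
      rw [coeff_mk, WittVector.coeff_truncate, WittVector.coeff_truncate, WittVector.map_coeff]
    rw [← map_mul, h, h, h, map_mul, map_mul]
  map_add' x y := by
    obtain ⟨x, rfl⟩ := WittVector.truncate_surjective p n R x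
    obtain ⟨y, rfl⟩ := WittVector.truncate_surjective p n R y
    have h : ∀ z : WittVector p R, (mk p fun i => f ((WittVector.truncate n z).coeff i)) =
        WittVector.truncate n (WittVector.map f z) := fun z => by
      ext i
      rw [coeff_mk, WittVector.coeff_truncate, WittVector.coeff_truncate, WittVector.map_coeff]
    rw [← map_add, h, h, h, map_add, map_add]

@[simp]
theorem coeff_map (f : R →+* S) (x : TruncatedWittVector p n R) (i : Fin n) :
    (map f x).coeff i = f (x.coeff i) := rfl

theorem map_id : map (RingHom.id R) = RingHom.id (TruncatedWittVector p n R) := rfl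

theorem map_comp (g : S →+* T) (f : R →+* S) :
    (map (g.comp f) : TruncatedWittVector p n R →+* _) = (map g).comp (map f) := rfl

/-- The projection `W_n(R) → R`, `(x_1, …, x_n) ↦ x_1`, for `n ≥ 1`. -/
def firstCoeff [NeZero n] : TruncatedWittVector p n R →+* R where
  toFun x := x.coeff 0
  map_one' := by
    rw [← map_one (WittVector.truncate n), WittVector.coeff_truncate]
    exact WittVector.one_coeff_zero p R
  map_zero' := coeff_zero p n R 0
  map_mul' x y := by
    obtain ⟨x, rfl⟩ := WittVector.truncate_surjective p n R x
    obtain ⟨y, rfl⟩ := WittVector.truncate_surjective p n R y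
    rw [← map_mul, WittVector.coeff_truncate, WittVector.coeff_truncate, WittVector.coeff_truncate]
    exact WittVector.mul_coeff_zero x y
  map_add' x y := by
    obtain ⟨x, rfl⟩ := WittVector.truncate_surjective p n R x
    obtain ⟨y, rfl⟩ := WittVector.truncate_surjective p n R y
    rw [← map_add, WittVector.coeff_truncate, WittVector.coeff_truncate, WittVector.coeff_truncate]
    exact WittVector.add_coeff_zero x y

/-- The Witt vector Frobenius `Φ : W_n(k) → W_n(k)` of a ring `k` of characteristic `p`,
`(a_1, …, a_n) ↦ (a_1 ^ p, …, a_n ^ p)`. -/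
def frobeniusMap (p : ℕ) [Fact p.Prime] (n : ℕ) (k : Type*) [CommRing k] [CharP k p] :
    TruncatedWittVector p n k →+* TruncatedWittVector p n k :=
  map (_root_.frobenius k p)

/-- `frobeniusMap` is induced by the Frobenius of the full ring of Witt vectors. -/
theorem frobeniusMap_truncate {k : Type*} [CommRing k] [CharP k p] (x : WittVector p k) :
    frobeniusMap p n k (WittVector.truncate n x) =
      WittVector.truncate n (WittVector.frobenius x) := by
  ext i
  rw [frobeniusMap, coeff_map, WittVector.coeff_truncate, WittVector.coeff_truncate,
    WittVector.coeff_frobenius_charP]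
  rfl

end TruncatedWittVector

namespace AlgebraicGeometry.Scheme

variable (p : ℕ) [Fact p.Prime] (n : ℕ)

/-- The presheaf of rings `U ↦ W_n(Γ(X, U))`. -/
def wittPresheaf (X : Scheme.{u}) : TopCat.Presheaf CommRingCat.{u} X where
  obj U := CommRingCat.of (TruncatedWittVector p n (X.presheaf.obj U))
  map f := CommRingCat.ofHom (TruncatedWittVector.map (X.presheaf.map f).hom)
  map_id U := by
    rw [X.presheaf.map_id]
    rfl
  map_comp f g := by
    rw [X.presheaf.map_comp]
    rfl

theorem wittPresheaf_isSheaf (X : Scheme.{u}) : (X.wittPresheaf p n).IsSheaf := by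
  rw [TopCat.Presheaf.isSheaf_iff_isSheafUniqueGluing]
  intro ι U sf hsf
  have key : ∀ j : Fin n, ∃! s : X.presheaf.obj (op (iSup U)),
      TopCat.Presheaf.IsGluing X.presheaf U
        (fun i => TruncatedWittVector.coeff j (sf i)) s := fun j =>
    X.sheaf.existsUnique_gluing U _
      fun i i' => congrArg (TruncatedWittVector.coeff (p := p)
        (R := X.presheaf.obj (op (U i ⊓ U i'))) j) (hsf i i')
  choose s hs huniq using key
  refine ⟨TruncatedWittVector.mk p s, fun i => ?_, fun t ht => ?_⟩
  · exact TruncatedWittVector.ext fun j => hs j i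
  · exact TruncatedWittVector.ext fun j =>
      huniq j _ fun i => congrArg (TruncatedWittVector.coeff j) (ht i)

/-- The sheaf of rings `W_n 𝒪_X` on `X`. -/
def wittSheaf (X : Scheme.{u}) : TopCat.Sheaf CommRingCat.{u} X :=
  ⟨X.wittPresheaf p n, X.wittPresheaf_isSheaf p n⟩

end AlgebraicGeometry.Scheme

namespace AlgebraicGeometry

section Structure

variable {R : Type u} [CommRing R] {X : Scheme.{u}} (f : X ⟶ Spec (CommRingCat.of R))

/-- For a scheme `f : X ⟶ Spec R`, the structure map from the constant presheaf `R` to `𝒪_X`. -/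
def structureMap : (Functor.const _).obj (CommRingCat.of R) ⟶ X.presheaf where
  app U := (Scheme.ΓSpecIso (CommRingCat.of R)).inv ≫ f.appTop ≫
    X.presheaf.map (homOfLE le_top : U.unop ⟶ ⊤).op
  naturality U V g := by
    simp only [Functor.const_obj_obj, Functor.const_obj_map, Category.id_comp, Category.assoc,
      ← X.presheaf.map_comp]
    rfl

/-- The `R`-algebra structure map `R → Γ(X, U)`. -/
def algMap (U : X.Opens) : R →+* Γ(X, U) := ((structureMap f).app (op U)).hom

/-- The presheaf of modules `U ↦ Ω¹_{Γ(X, U)/R}` of Kähler differentials. -/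
def kaehlerPresheaf : X.PresheafOfModules :=
  PresheafOfModules.DifferentialsConstruction.relativeDifferentials' (structureMap f)

/-- The sheaf of differentials `Ω¹_{X/R}`: the sheaf of `𝒪_X`-modules associated with
`U ↦ Ω¹_{Γ(X, U)/R}`. -/
def kaehlerSheaf : X.Modules :=
  (PresheafOfModules.sheafification (𝟙 X.ringCatSheaf.obj)).obj (kaehlerPresheaf f)

/-- The canonical map from Kähler differentials of `Γ(X, U)` over `R` to `Γ(U, Ω¹_{X/R})`. -/
def toKaehlerSheaf (U : X.Opens) :
    (kaehlerPresheaf f).presheaf.obj (op U) ⟶ (kaehlerSheaf f).presheaf.obj (op U) :=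
  ((PresheafOfModules.toPresheaf _).map
    ((PresheafOfModules.sheafificationAdjunction (𝟙 X.ringCatSheaf.obj)).unit.app
      (kaehlerPresheaf f))).app (op U)

/-- The de Rham differential `d : 𝒪_X → Ω¹_{X/R}` on sections over `U`. -/
def deRhamD (U : X.Opens) : Γ(X, U) →+ (kaehlerSheaf f).presheaf.obj (op U) :=
  (toKaehlerSheaf f U).hom.comp
    (PresheafOfModules.DifferentialsConstruction.derivation' (structureMap f)).d

end Structure

section Frobenius

variable (p : ℕ) [Fact p.Prime] (n : ℕ) {X X' : Scheme.{u}} (i : X ⟶ X')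

/-- For `i : X ⟶ X'` (a homeomorphism in the case of interest), `W_n 𝒪_X` viewed as a sheaf of
rings on `X'`; its ring of sections over `U` is `W_n(Γ(X, i⁻¹ U))`. -/
def wittSheafOn : TopCat.Sheaf CommRingCat.{u} X' :=
  (TopCat.Sheaf.pushforward CommRingCat i.base).obj (X.wittSheaf p n)

/-- A map of sheaves of sets `W_n 𝒪_X → 𝒪_{X'}` is given by the formula
`(x_1, …, x_n) ↦ ∑ p ^ j * x̃_{j+1} ^ (p ^ (n - j))`, `j = 0, …, n - 1`, for all sections
`x_1, …, x_n` over an open set and all lifts `x̃_1, …, x̃_n` over that open set. -/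
def IsTildeF (φ : (wittSheafOn p n i).obj ⋙ forget CommRingCat.{u} ⟶
    X'.presheaf ⋙ forget CommRingCat.{u}) : Prop :=
  ∀ (U : X'.Opens) (x : TruncatedWittVector p n Γ(X, i ⁻¹ᵁ U)) (y : Fin n → Γ(X', U)),
    (∀ j, i.app U (y j) = x.coeff j) →
      φ.app (op U) x = (∑ j : Fin n, (p : Γ(X', U)) ^ (j : ℕ) * y j ^ p ^ (n - (j : ℕ)) : Γ(X', U))

variable {p n i}

/-- The ring homomorphism `W_n(Γ(X, i⁻¹ U)) → Γ(X', U)` on sections over `U`. -/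
def onSections (F : wittSheafOn p n i ⟶ X'.sheaf) (U : X'.Opens) :
    TruncatedWittVector p n Γ(X, i ⁻¹ᵁ U) →+* Γ(X', U) :=
  (F.hom.app (op U)).hom

end Frobenius

end AlgebraicGeometry

end

/-! The map is the ghost component `w_n`. Since `p ^ n = 0` on `X'`, its last term vanishes, and
what remains depends only on the components modulo `p`, because `a ≡ b` mod `p` gives `a ^ p ^ r ≡ b
^ p ^ r` mod `p ^ (r + 1)`. Over an affine open every Witt vector over `𝒪_X` lifts to one over
`𝒪_{X'}`, so the ring homomorphism `w_n` descends to `W_n 𝒪_X`. The descended maps glue, and `d`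
kills their values because each term `p ^ j * y ^ p ^ (n - j)` has differential divisible by `p ^
n`.

The other assertions are local, on standard smooth affines `B` with reduction `R = B / p`. By
flatness `p ^ j b = 0` forces `p ^ (n - j) ∣ b`. As `R` is reduced, a vanishing ghost sum has all
its components divisible by `p`, one after the other; this is injectivity.

For the kernel of `d`, suppose `db = 0` and `b = ∑_{j<m} p ^ j y_j ^ p ^ (m - j) + p ^ m z`.
Dividing `db` by `p ^ m` yields `∑ y_j ^ (p ^ (m - j) - 1) dy_j = -dz` modulo `p`. The Cartier
operator kills exact forms and sends `u ^ (p ^ (r + 1) - 1) du` to `u ^ (p ^ r - 1) du`; iterating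
it gives `dy_j = 0` and `dz = 0` in `R`. Closed functions on `R` are `p`-th powers, so each `y_j`
and `z` is a `p`-th power plus a multiple of `p`, and `m` increases to `m + 1`
(`IsFlatThickening.exists_eq_ghostSum`). The Cartier operator enters through Hochschild's formula
for `D^[p - 1]`, one coordinate derivation `D` at a time.

Semilinearity reduces to constants: lifting the components of `a` by Teichmüller representatives
turns the ghost sum into `Φ^n a`. -/

noncomputable section

/-! ### Derivations with a coordinate function in characteristic `p` -/

namespace Derivation

variable {R : Type*} [CommRing R]

theorem iterate_mul_of_apply_eq_zero (D : Derivation ℤ R R) {c : R} (hc : D c = 0) (m : ℕ)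
    (y : R) : D^[m] (c * y) = c * D^[m] y := by
  induction m generalizing y with
  | zero => rfl
  | succ m ih =>
    rw [Function.iterate_succ_apply, Function.iterate_succ_apply, D.leibniz, hc, smul_zero,
      add_zero, smul_eq_mul, ih]

theorem iterate_map_add' (D : Derivation ℤ R R) (m : ℕ) (a b : R) :
    D^[m] (a + b) = D^[m] a + D^[m] b := by
  rw [Function.Semiconj₂.iterate (f := D) (op := (· + ·)) (fun a b => map_add D a b) m a b]

theorem iterate_map_sum' (D : Derivation ℤ R R) (m : ℕ) {ι : Type*} (s : Finset ι) (g : ι → R) :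
    D^[m] (∑ j ∈ s, g j) = ∑ j ∈ s, D^[m] (g j) := by
  have h : ∀ x, D^[m] x = ((D : R →ₗ[ℤ] R) ^ m) x := fun x => by
    rw [Module.End.pow_apply]; rfl
  simp only [h, map_sum]

theorem iterate_pow_of_apply_eq_one (D : Derivation ℤ R R) {x : R} (hx : D x = 1) (j m : ℕ) :
    D^[j] (x ^ m) = (m.descFactorial j : R) * x ^ (m - j) := by
  induction j with
  | zero => simp
  | succ j ih =>
    rw [Function.iterate_succ_apply', ih, D.leibniz, D.leibniz_pow, hx, D.map_natCast,
      Nat.descFactorial_succ, Nat.sub_sub]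
    simp only [smul_eq_mul, nsmul_eq_mul, mul_one, mul_zero, add_zero]
    push_cast
    ring

theorem apply_pow_char (p : ℕ) [CharP R p] (D : Derivation ℤ R R) (a : R) : D (a ^ p) = 0 := by
  rw [D.leibniz_pow, ← Nat.cast_smul_eq_nsmul R, CharP.cast_eq_zero, zero_smul]

variable (p : ℕ) [hp : Fact p.Prime] [CharP R p]

/-- The constants of a derivation. -/
def constants (D : Derivation ℤ R R) : Subring R where
  carrier := {c | D c = 0}
  mul_mem' {a b} ha hb := by
    simp only [Set.mem_ofPred_eq] at *
    rw [D.leibniz, ha, hb, smul_zero, smul_zero, add_zero]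
  one_mem' := D.map_one_eq_zero
  add_mem' {a b} ha hb := by
    simp only [Set.mem_ofPred_eq] at *
    rw [map_add, ha, hb, add_zero]
  zero_mem' := map_zero D
  neg_mem' {a} ha := by
    simp only [Set.mem_ofPred_eq] at *
    rw [map_neg, ha, neg_zero]

theorem exists_polynomial_eval₂_eq {C : Subring R} {x b : R} {s : Set R} (hs : s ⊆ C)
    (hb : b ∈ Subring.closure (insert x s)) :
    ∃ q : Polynomial C, q.eval₂ C.subtype x = b := by
  have : Subring.closure (insert x s) ≤ (Polynomial.eval₂RingHom C.subtype x).range := by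
    rw [Subring.closure_le]
    rintro y (rfl | hy)
    · exact ⟨Polynomial.X, by simp⟩
    · exact ⟨Polynomial.C ⟨y, hs hy⟩, by simp⟩
  exact this hb

/-- One of `m + 1, …, m + p - 1` is a multiple of `p`. The proof multiplies by `m` to get a product
of `p` consecutive integers. -/
theorem cast_descFactorial_eq_zero {m : ℕ} (hm : ¬ p ∣ m) :
    ((m + p - 1).descFactorial (p - 1) : R) = 0 := by
  rw [CharP.cast_eq_zero_iff R p]
  have h1 := Nat.factorial_dvd_descFactorial (m + p - 1) p
  have h2 : (m + p - 1).descFactorial p = m * (m + p - 1).descFactorial (p - 1) := by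
    obtain ⟨q, rfl⟩ : ∃ q, p = q + 1 := ⟨p - 1, by have := hp.1.pos; omega⟩
    rw [Nat.descFactorial_succ]
    congr 1
    omega
  rw [h2] at h1
  exact (hp.1.dvd_mul.1 ((Nat.dvd_factorial hp.1.pos le_rfl).trans h1)).resolve_left hm

theorem cast_factorial_pred : ((p - 1).factorial : R) = -1 := by
  have h := ZMod.wilsons_lemma p
  have := congrArg (ZMod.castHom (dvd_refl p) R) h
  rwa [_root_.map_natCast, _root_.map_neg, _root_.map_one] at this

/-- A constant of `D` lying in `C[x]` lies in `C[x ^ p]`, when `D` kills `C` and `D x = 1`. -/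
theorem mem_of_apply_eq_zero (D : Derivation ℤ R R) {x b : R} (hx : D x = 1) {C : Subring R}
    (hC : C ≤ D.constants) {s : Set R} (hs : s ⊆ C) (hpow : x ^ p ∈ C)
    (hb : b ∈ Subring.closure (insert x s)) (hDb : D b = 0) : b ∈ C := by
  obtain ⟨q, rfl⟩ := exists_polynomial_eval₂_eq hs hb
  set b := q.eval₂ C.subtype x with hbdef
  -- By Wilson, `D^[p - 1] (x ^ (p - 1)) = (p - 1)! = -1`. Expanding `b` in powers of `x`, the
  -- right-hand side keeps only the exponents divisible by `p`.
  have h1 : b = -D^[p - 1] (b * x ^ (p - 1)) := by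
    rw [iterate_mul_of_apply_eq_zero D hDb, iterate_pow_of_apply_eq_one D hx,
      Nat.descFactorial_self, cast_factorial_pred]
    simp
  rw [h1, hbdef, Polynomial.eval₂_eq_sum_range, Finset.sum_mul, iterate_map_sum']
  refine neg_mem (sum_mem fun m _ => ?_)
  rw [mul_assoc, ← pow_add, Subring.subtype_apply, iterate_mul_of_apply_eq_zero D (hC (q.coeff m).2),
    iterate_pow_of_apply_eq_one D hx, ← Nat.add_sub_assoc hp.1.one_le]
  by_cases hm : p ∣ m
  · obtain ⟨r, rfl⟩ := hm
    have : p * r + p - 1 - (p - 1) = p * r := by have := hp.1.one_le; omega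
    rw [this, pow_mul]
    exact mul_mem (q.coeff _).2 (mul_mem (natCast_mem _ _) (pow_mem hpow _))
  · rw [cast_descFactorial_eq_zero p hm, zero_mul, mul_zero]
    exact zero_mem _

/-- The ring consists of polynomials in `x` over the constants, and `D^[p] (x ^ m)` carries a
product of `p` consecutive integers. -/
theorem iterate_char_eq_zero (D : Derivation ℤ R R) {x : R} (hx : D x = 1)
    (htop : Subring.closure (insert x (D.constants : Set R)) = ⊤) (b : R) : D^[p] b = 0 := by
  obtain ⟨q, rfl⟩ := exists_polynomial_eval₂_eq (C := D.constants) subset_rfl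
    (show b ∈ Subring.closure (insert x (D.constants : Set R)) by rw [htop]; trivial)
  rw [Polynomial.eval₂_eq_sum_range, iterate_map_sum']
  refine Finset.sum_eq_zero fun m _ => ?_
  rw [Subring.subtype_apply, iterate_mul_of_apply_eq_zero D (q.coeff m).2, iterate_pow_of_apply_eq_one D hx,
    (CharP.cast_eq_zero_iff R p _).2 ((Nat.dvd_factorial hp.1.pos le_rfl).trans
      (Nat.factorial_dvd_descFactorial m p)), zero_mul, mul_zero]

/-- The form `f ^ (p - 1) df` is additive in `f` modulo exact forms. -/
theorem exists_add_pow_pred_mul (D : Derivation ℤ R R) (f g : R) :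
    ∃ h, (f + g) ^ (p - 1) * D (f + g) = f ^ (p - 1) * D f + g ^ (p - 1) * D g + D h := by
  obtain ⟨q, rfl⟩ : ∃ q, p = q + 1 := ⟨p - 1, by have := hp.1.pos; omega⟩
  have hdvd : ∀ j ∈ Finset.range q, (q + 1) ∣ (q + 1).choose (j + 1) := fun j hj =>
    hp.1.dvd_choose_self (Nat.succ_ne_zero j) (by have := Finset.mem_range.1 hj; omega)
  -- With `p = q + 1`, the primitive is the formal expression `((f + g) ^ p - f ^ p - g ^ p) / p`,
  -- whose coefficients are these integers.
  let c : ℕ → ℕ := fun j => (q + 1).choose (j + 1) / (q + 1)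
  have hc : ∀ j ∈ Finset.range q, (q + 1) * c j = (q + 1).choose (j + 1) := fun j hj =>
    Nat.mul_div_cancel' (hdvd j hj)
  have hc1 : ∀ j ∈ Finset.range q, c j * (j + 1) = q.choose j := fun j hj => by
    have h := Nat.add_one_mul_choose_eq q j
    rw [← hc j hj, mul_assoc] at h
    exact (Nat.eq_of_mul_eq_mul_left (Nat.succ_pos q) h).symm
  have hc2 : ∀ j ∈ Finset.range q, c j * (q - j) = q.choose (j + 1) := fun j hj => by
    have h := Nat.choose_succ_right_eq (q + 1) (j + 1)
    have h' := Nat.add_one_mul_choose_eq q (j + 1)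
    have : (q + 1) * (c j * (q - j)) = (q + 1) * q.choose (j + 1) := by
      rw [← mul_assoc, hc j hj, h', h, Nat.add_sub_add_right]
    exact Nat.eq_of_mul_eq_mul_left (Nat.succ_pos q) this
  refine ⟨∑ j ∈ Finset.range q, (c j : R) * (f ^ (j + 1) * g ^ (q - j)), ?_⟩
  have hD : D (∑ j ∈ Finset.range q, (c j : R) * (f ^ (j + 1) * g ^ (q - j))) =
      (∑ j ∈ Finset.range q, f ^ j * g ^ (q - j) * (q.choose j : R)) * D f +
      (∑ j ∈ Finset.range q, f ^ (j + 1) * g ^ (q - (j + 1)) * (q.choose (j + 1) : R)) * D g := by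
    rw [map_sum, Finset.sum_mul, Finset.sum_mul, ← Finset.sum_add_distrib]
    refine Finset.sum_congr rfl fun j hj => ?_
    rw [D.leibniz, D.leibniz, D.leibniz_pow, D.leibniz_pow, D.map_natCast, ← hc1 j hj, ← hc2 j hj]
    simp only [smul_eq_mul, nsmul_eq_mul, mul_zero, add_zero, Nat.add_sub_cancel, Nat.sub_sub]
    push_cast
    ring
  have h1 := Finset.sum_range_succ (fun j => f ^ j * g ^ (q - j) * (q.choose j : R)) q
  have h2 := Finset.sum_range_succ' (fun j => f ^ j * g ^ (q - j) * (q.choose j : R)) q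
  rw [← add_pow] at h1 h2
  simp only [Nat.sub_self, pow_zero, mul_one, Nat.choose_self, Nat.cast_one, Nat.sub_zero,
    one_mul, Nat.choose_zero_right] at h1 h2
  rw [hD, Nat.add_sub_cancel, map_add, mul_add]
  nth_rewrite 1 [h1]
  rw [h2]
  ring

/-- Hochschild's formula for a derivation with a coordinate function. -/
theorem iterate_pred_pow_pred_mul (D : Derivation ℤ R R) {x : R} (hx : D x = 1)
    (htop : Subring.closure (insert x (D.constants : Set R)) = ⊤) (f : R) :
    D^[p - 1] (f ^ (p - 1) * D f) = -(D f) ^ p := by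
  have hpow : ∀ a : R, a ^ (p - 1) * a = a ^ p := fun a => by
    rw [← pow_succ, Nat.sub_add_cancel hp.1.one_le]
  have hf : f ∈ Subring.closure (insert x (D.constants : Set R)) := by rw [htop]; trivial
  have hconst : ∀ c, D c = 0 → D^[p - 1] (c ^ (p - 1) * D c) = -(D c) ^ p := fun c hc => by
    rw [hc, mul_zero, zero_pow hp.1.ne_zero, neg_zero]
    exact Function.iterate_fixed (map_zero D) _
  -- The elements satisfying the formula form a subring: in the additive step the exact correction
  -- term dies because `D^[p] = 0`. It contains `x` (Wilson) and the constants.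
  induction hf using Subring.closure_induction with
  | mem y hy =>
    rcases hy with rfl | hy
    · rw [hx, mul_one, iterate_pow_of_apply_eq_one D hx, Nat.descFactorial_self,
        cast_factorial_pred]
      simp
    · exact hconst y hy
  | zero => exact hconst 0 (map_zero D)
  | one => exact hconst 1 D.map_one_eq_zero
  | add a b _ _ ha hb =>
    obtain ⟨h, hh⟩ := exists_add_pow_pred_mul p D a b
    rw [hh, iterate_map_add', iterate_map_add', ha, hb, ← Function.iterate_succ_apply,
      Nat.succ_eq_add_one, Nat.sub_add_cancel hp.1.one_le, iterate_char_eq_zero p D hx htop,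
      map_add, add_pow_char]
    ring
  | neg a _ ha =>
    have h1 : (-a) ^ (p - 1) * D (-a) = (-1) ^ p * (a ^ (p - 1) * D a) := by
      rw [← hpow (-1), map_neg, neg_pow a]; ring
    have h2 : D ((-1) ^ p) = 0 := apply_pow_char p D _
    rw [h1, iterate_mul_of_apply_eq_zero D h2, ha, map_neg, neg_pow (D a)]
    ring
  | mul a b _ _ ha hb =>
    have h1 : (a * b) ^ (p - 1) * D (a * b) =
        a ^ p * (b ^ (p - 1) * D b) + b ^ p * (a ^ (p - 1) * D a) := by
      rw [← hpow a, ← hpow b, D.leibniz]; simp only [smul_eq_mul]; ring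
    rw [h1, iterate_map_add', iterate_mul_of_apply_eq_zero D (apply_pow_char p D a),
      iterate_mul_of_apply_eq_zero D (apply_pow_char p D b), ha, hb, D.leibniz, add_pow_char]
    simp only [smul_eq_mul, mul_pow]
    ring

end Derivation

/-! ### Coordinates over `p`-th powers and the iterated Cartier operator -/

/-- Functions `x i` on a ring `R` of characteristic `p` that generate it over its `p`-th powers,
with derivations `D i` dual to them. -/
structure IsPCoordinates (p : ℕ) {R : Type*} [CommRing R] {ι : Type*} [DecidableEq ι] (x : ι → R)
    (D : ι → Derivation ℤ R R) : Prop where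
  apply_eq : ∀ i j, D i (x j) = if i = j then 1 else 0
  closure_eq_top : Subring.closure (Set.range x ∪ Set.range fun a : R => a ^ p) = ⊤

namespace IsPCoordinates

variable {p : ℕ} [hp : Fact p.Prime] {R : Type*} [CommRing R] [CharP R p] {ι : Type*} [Fintype ι]
  [DecidableEq ι] {x : ι → R} {D : ι → Derivation ℤ R R} (h : IsPCoordinates p x D)

include h

omit [Fintype ι] hp in
theorem closure_insert_constants (i : ι) :
    Subring.closure (insert (x i) ((D i).constants : Set R)) = ⊤ := by
  rw [eq_top_iff, ← h.closure_eq_top, Subring.closure_le]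
  rintro _ (⟨j, rfl⟩ | ⟨a, rfl⟩)
  · by_cases hij : i = j
    · subst hij
      exact Subring.subset_closure (Set.mem_insert _ _)
    · refine Subring.subset_closure (Set.mem_insert_of_mem _ ?_)
      exact (h.apply_eq i j).trans (if_neg hij)
  · exact Subring.subset_closure (Set.mem_insert_of_mem _ ((D i).apply_pow_char p a))

/-- An element killed by all derivations is a `p`-th power. -/
theorem exists_pow_eq {b : R} (hb : ∀ i, D i b = 0) : ∃ a, a ^ p = b := by
  -- Coordinates are eliminated one at a time: `D i` kills the other coordinates and all `p`-th
  -- powers, so an element killed by `D i` can be written without `x i`, whose `p`-th power remains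
  -- available.
  suffices H : ∀ (s : Finset ι) (b : R),
      b ∈ Subring.closure (x '' s ∪ Set.range fun a : R => a ^ p) → (∀ i, D i b = 0) →
        b ∈ (frobenius R p).range by
    obtain ⟨a, ha⟩ := H Finset.univ b
      (by rw [Finset.coe_univ, Set.image_univ, h.closure_eq_top]; trivial) hb
    exact ⟨a, ha⟩
  intro s
  induction s using Finset.induction_on with
  | empty =>
    intro b hb _
    refine (Subring.closure_le.2 ?_) hb
    rintro _ (hx | ⟨a, rfl⟩)
    · simp at hx
    · exact ⟨a, rfl⟩
  | insert i s his ih =>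
    intro b hb hD
    refine ih b ?_ hD
    refine Derivation.mem_of_apply_eq_zero p (D i) (x := x i) (by simpa using h.apply_eq i i)
      (s := x '' s ∪ Set.range fun a : R => a ^ p) ?_ Subring.subset_closure
      (Subring.subset_closure (Or.inr ⟨x i, rfl⟩)) ?_ (hD i)
    · rw [Subring.closure_le]
      rintro _ (⟨j, hj, rfl⟩ | ⟨a, rfl⟩)
      · have hij : i ≠ j := fun hij => his (by subst hij; exact hj)
        exact (h.apply_eq i j).trans (if_neg hij)
      · exact (D i).apply_pow_char p a
    · rwa [Finset.coe_insert, Set.image_insert_eq, Set.insert_union] at hb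

omit [Fintype ι] in
/-- Applying the Cartier operator to an exact form. -/
theorem sum_pow_mul_eq_zero [IsReduced R] {N : ℕ} {u : ℕ → R} {z : R} (i : ι)
    (hu : ∑ m ∈ Finset.range N, u m ^ (p ^ (m + 1) - 1) * D i (u m) = D i z) :
    ∑ m ∈ Finset.range N, u m ^ (p ^ m - 1) * D i (u m) = 0 := by
  have hx : D i (x i) = 1 := by simpa using h.apply_eq i i
  have htop := h.closure_insert_constants i
  have h1 : ∀ m, u m ^ (p ^ (m + 1) - 1) * D i (u m) =
      (u m ^ (p ^ m - 1)) ^ p * (u m ^ (p - 1) * D i (u m)) := fun m => by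
    rw [← mul_assoc, ← pow_mul, ← pow_add]
    congr 2
    have : 1 ≤ p ^ m := Nat.one_le_pow _ _ hp.1.pos
    rw [Nat.sub_mul, ← pow_succ, one_mul]
    have h2 : p ≤ p ^ (m + 1) := by rw [pow_succ]; exact Nat.le_mul_of_pos_left _ this
    have := hp.1.one_le
    omega
  -- The exact side becomes `D^[p] z = 0`, while Hochschild's formula makes the other side minus the
  -- `p`-th power of the desired sum; reducedness extracts the root.
  have h2 := congrArg ((D i)^[p - 1]) hu
  rw [Derivation.iterate_map_sum', ← Function.iterate_succ_apply, Nat.succ_eq_add_one,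
    Nat.sub_add_cancel hp.1.one_le, Derivation.iterate_char_eq_zero p (D i) hx htop] at h2
  refine pow_eq_zero_iff hp.1.ne_zero |>.1 ?_
  rw [sum_pow_char, ← neg_eq_zero, ← Finset.sum_neg_distrib, ← h2]
  refine Finset.sum_congr rfl fun m _ => ?_
  rw [h1, Derivation.iterate_mul_of_apply_eq_zero _ (Derivation.apply_pow_char p _ _),
    Derivation.iterate_pred_pow_pred_mul p _ hx htop, mul_pow, mul_neg]

-- One Cartier step lowers every exponent and turns the term `m = 0` into `D i (u 0)`. Moved to the
-- right, it is the new exact form, so the hypothesis holds for the shifted family with one term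
-- fewer.
omit [Fintype ι] in
theorem apply_eq_zero_of_sum_pow_mul [IsReduced R] {N : ℕ} {u : ℕ → R} {z : R}
    (hu : ∀ i, ∑ m ∈ Finset.range N, u m ^ (p ^ (m + 1) - 1) * D i (u m) = D i z) :
    ∀ m < N, ∀ i, D i (u m) = 0 := by
  induction N generalizing u z with
  | zero => intro m hm; omega
  | succ N ih =>
    have h1 : ∀ i, ∑ m ∈ Finset.range N, u (m + 1) ^ (p ^ (m + 1) - 1) * D i (u (m + 1)) =
        D i (-u 0) := fun i => by
      have := h.sum_pow_mul_eq_zero i (hu i)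
      rw [Finset.sum_range_succ'] at this
      simp only [pow_zero, Nat.sub_self, one_mul] at this
      rw [map_neg]
      exact eq_neg_of_add_eq_zero_left this
    have h2 := ih h1
    intro m hm i
    cases m with
    | succ m => exact h2 m (by omega) i
    | zero =>
      have := h1 i
      rw [Finset.sum_eq_zero fun m hm => by rw [h2 m (Finset.mem_range.1 hm) i, mul_zero],
        map_neg] at this
      exact neg_eq_zero.1 this.symm

end IsPCoordinates

/-! ### The truncated ghost component -/

/-- The ghost polynomial `∑ p ^ j * y j ^ (p ^ (n - j))`, `j = 0, …, n - 1`. -/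
def ghostSum (p n : ℕ) {B : Type*} [CommRing B] (y : ℕ → B) : B :=
  ∑ j ∈ Finset.range n, (p : B) ^ j * y j ^ p ^ (n - j)

section GhostSum

variable {p n : ℕ} {B : Type*} [CommRing B]

theorem ghostSum_eq_sum_fin (y : ℕ → B) :
    ghostSum p n y = ∑ j : Fin n, (p : B) ^ (j : ℕ) * y j ^ p ^ (n - (j : ℕ)) :=
  Finset.sum_range fun j => (p : B) ^ j * y j ^ p ^ (n - j)

/-- Raising a congruence modulo `p` to the power `p ^ (m - j)` gains `m - j` factors `p`, and the
coefficient contributes `j` more. -/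
theorem pow_mul_pow_eq_add {a b t : B} {j m : ℕ} (hab : a = b + p * t) (hjm : j ≤ m) :
    ∃ s, (p : B) ^ j * a ^ p ^ (m - j) = (p : B) ^ j * b ^ p ^ (m - j) + (p : B) ^ (m + 1) * s := by
  have h := dvd_sub_pow_of_dvd_sub (p := p) (a := a) (b := b) ⟨t, by rw [hab]; ring⟩ (m - j)
  obtain ⟨s, hs⟩ := h
  refine ⟨s, ?_⟩
  have h1 : (p : B) ^ (m + 1) = (p : B) ^ j * (p : B) ^ (m - j + 1) := by
    rw [← pow_add]; congr 1; omega
  rw [h1, mul_assoc, ← hs]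
  ring

theorem ghostSum_congr (hn : (p : B) ^ n = 0) {y y' : ℕ → B}
    (h : ∀ j < n, (p : B) ∣ y j - y' j) : ghostSum p n y = ghostSum p n y' := by
  refine Finset.sum_congr rfl fun j hj => ?_
  obtain ⟨t, ht⟩ := h j (Finset.mem_range.1 hj)
  obtain ⟨s, hs⟩ := pow_mul_pow_eq_add (p := p) (eq_add_of_sub_eq' ht) (Finset.mem_range.1 hj).le
  rw [hs, pow_succ, hn]
  ring

/-- The two differ by the term `p ^ n * z_n`. This identity makes the ghost sum additive and
multiplicative for Witt vector operations. -/
theorem ghostSum_coeff [Fact p.Prime] (hn : (p : B) ^ n = 0) (z : WittVector p B) :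
    ghostSum p n z.coeff = WittVector.ghostComponent n z := by
  rw [WittVector.ghostComponent_apply, wittPolynomial_eq_sum_C_mul_X_pow, map_sum,
    Finset.sum_range_succ]
  simp [ghostSum, hn]

theorem apply_ghostSum_eq_zero (hn : (p : B) ^ n = 0) {M : Type*} [AddCommGroup M] [Module B M]
    (D : Derivation ℤ B M) (y : ℕ → B) : D (ghostSum p n y) = 0 := by
  rw [ghostSum, map_sum]
  refine Finset.sum_eq_zero fun j hj => ?_
  have h0 : D ((p : B) ^ j) = 0 := by rw [← Nat.cast_pow, D.map_natCast]
  rw [D.leibniz, h0, smul_zero, add_zero, D.leibniz_pow, ← Nat.cast_smul_eq_nsmul B, smul_smul,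
    Nat.cast_pow, ← pow_add, Nat.add_sub_cancel' (Finset.mem_range.1 hj).le, hn, zero_smul]

end GhostSum

/-! ### Injectivity and closed functions on a flat thickening -/

/-- A ring `B` with `p ^ n = 0`, flat over `ℤ / p ^ n`, whose reduction `π : B → R` modulo `p`
is reduced. -/
structure IsFlatThickening (p n : ℕ) {B R : Type*} [CommRing B] [CommRing R] (π : B →+* R) :
    Prop where
  pow_eq_zero : (p : B) ^ n = 0
  dvd_of_pow_mul_eq_zero : ∀ j ≤ n, ∀ b : B, (p : B) ^ j * b = 0 → (p : B) ^ (n - j) ∣ b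
  surjective : Function.Surjective π
  map_eq_zero_iff : ∀ b, π b = 0 ↔ (p : B) ∣ b

namespace IsFlatThickening

variable {p n : ℕ} [hp : Fact p.Prime] {B R : Type*} [CommRing B] [CommRing R]
  {π : B →+* R} (h : IsFlatThickening p n π)

include h

omit hp in
theorem map_eq_zero_of_pow_mul {j : ℕ} (hj : j < n) {b : B} (hb : (p : B) ^ j * b = 0) :
    π b = 0 :=
  (h.map_eq_zero_iff b).2
    ((dvd_pow_self (p : B) (by omega)).trans (h.dvd_of_pow_mul_eq_zero j hj.le b hb))

/-- If `y j` is divisible by `p` for `j < m`, those terms vanish since `j + p ^ (n - j) ≥ n`.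
Dividing the rest by `p ^ m` and reducing leaves only `y m ^ p ^ (n - m)`. -/
theorem map_eq_zero_of_ghostSum_eq_zero [IsReduced R] {y : ℕ → B} (hy : ghostSum p n y = 0) :
    ∀ m < n, π (y m) = 0 := by
  intro m
  induction m using Nat.strong_induction_on with
  | _ m ih =>
    intro hm
    have h1 : ghostSum p n y = (p : B) ^ m * ∑ j ∈ Finset.range (n - m),
        (p : B) ^ j * y (m + j) ^ p ^ (n - (m + j)) := by
      rw [ghostSum, ← Finset.sum_range_add_sum_Ico _ hm.le, Finset.sum_eq_zero, zero_add,
        Finset.sum_Ico_eq_sum_range, Finset.mul_sum]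
      · exact Finset.sum_congr rfl fun j _ => by rw [pow_add, mul_assoc]
      · intro j hj
        have hj := Finset.mem_range.1 hj
        obtain ⟨t, ht⟩ := (h.map_eq_zero_iff _).1 (ih j hj (by omega))
        have h2 : n = j + (n - j) := by omega
        have h3 := Nat.lt_pow_self (n := n - j) hp.1.one_lt
        rw [ht, mul_pow, ← mul_assoc, ← pow_add,
          pow_eq_zero_of_le (by omega : n ≤ j + p ^ (n - j)) h.pow_eq_zero, zero_mul]
    have h2 := h.map_eq_zero_of_pow_mul hm (h1 ▸ hy)
    have hp0 : π (p : B) = 0 := (h.map_eq_zero_iff _).2 dvd_rfl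
    obtain ⟨r, hr⟩ : ∃ r, n - m = r + 1 := ⟨n - m - 1, by omega⟩
    rw [map_sum, hr, Finset.sum_range_succ', Finset.sum_eq_zero, zero_add] at h2
    · rw [pow_zero, one_mul, add_zero, map_pow] at h2
      exact pow_eq_zero_iff (pow_ne_zero _ hp.1.ne_zero) |>.1 h2
    · intro j _
      rw [map_mul, map_pow, hp0, zero_pow (Nat.succ_ne_zero j), zero_mul]

theorem exists_eq_ghostSum [CharP R p] [IsReduced R] {ι : Type*} [Fintype ι] [DecidableEq ι]
    {x : ι → R} {D : ι → Derivation ℤ R R} (hD : IsPCoordinates p x D)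
    {d : ι → Derivation ℤ B B} (hd : ∀ i b, π (d i b) = D i (π b)) {b : B}
    (hb : ∀ i, d i b = 0) : ∃ y, b = ghostSum p n y := by
  suffices H : ∀ m ≤ n, ∃ (y : ℕ → B) (z : B), b = ghostSum p m y + (p : B) ^ m * z by
    obtain ⟨y, z, hyz⟩ := H n le_rfl
    exact ⟨y, by rw [hyz, h.pow_eq_zero, zero_mul, add_zero]⟩
  intro m
  induction m with
  | zero => exact fun _ => ⟨0, b, by simp [ghostSum]⟩
  | succ m ih =>
    intro hm
    obtain ⟨y, z, hyz⟩ := ih (by omega)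
    -- The index is reversed, `l = m - 1 - j`, so that the exponent `p ^ (m - j) - 1` has the form
    -- required by the Cartier lemma.
    have h1 : ∀ i, ∑ l ∈ Finset.range m, π (y (m - 1 - l)) ^ (p ^ (l + 1) - 1) *
        D i (π (y (m - 1 - l))) = D i (-π z) := by
      intro i
      have h2 : d i b = (p : B) ^ m * (∑ j ∈ Finset.range m,
          y j ^ (p ^ (m - j) - 1) * d i (y j) + d i z) := by
        have h0 : ∀ j, d i ((p : B) ^ j) = 0 := fun j => by
          rw [← Nat.cast_pow, Derivation.map_natCast]
        rw [hyz, map_add, ghostSum, map_sum, mul_add, Finset.mul_sum, Derivation.leibniz, h0,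
          smul_zero, add_zero, smul_eq_mul]
        congr 1
        refine Finset.sum_congr rfl fun j hj => ?_
        have hj := Finset.mem_range.1 hj
        rw [Derivation.leibniz, h0, smul_zero, add_zero, Derivation.leibniz_pow, smul_eq_mul,
          smul_eq_mul, nsmul_eq_mul, Nat.cast_pow, ← mul_assoc, ← pow_add,
          Nat.add_sub_cancel' hj.le]
      have h3 := h.map_eq_zero_of_pow_mul (j := m) (by omega) (h2.symm.trans (hb i))
      rw [map_add, map_sum, hd, ← Finset.sum_range_reflect] at h3
      rw [map_neg, ← eq_neg_of_add_eq_zero_left h3]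
      refine Finset.sum_congr rfl fun l hl => ?_
      have hl := Finset.mem_range.1 hl
      rw [map_mul, map_pow, hd]
      congr 4
      omega
    have h2 := hD.apply_eq_zero_of_sum_pow_mul h1
    have h3 : ∀ j < m, ∀ i, D i (π (y j)) = 0 := fun j hj i => by
      have := h2 (m - 1 - j) (by omega) i
      rwa [show m - 1 - (m - 1 - j) = j by omega] at this
    have h4 : ∀ i, D i (π z) = 0 := fun i => by
      have := h1 i
      rw [Finset.sum_eq_zero fun l hl => by rw [h2 l (Finset.mem_range.1 hl) i, mul_zero],
        map_neg] at this
      exact neg_eq_zero.1 this.symm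
    have h5 : ∀ c : B, (∀ i, D i (π c) = 0) → ∃ w t, c = w ^ p + p * t := fun c hc => by
      obtain ⟨a, ha⟩ := hD.exists_pow_eq hc
      obtain ⟨w, rfl⟩ := h.surjective a
      obtain ⟨t, ht⟩ := (h.map_eq_zero_iff (c - w ^ p)).1 (by rw [map_sub, map_pow, ha, sub_self])
      exact ⟨w, t, eq_add_of_sub_eq' ht⟩
    -- Replacing `y j` by `w ^ p` costs a multiple of `p ^ (m + 1)`. The bound `j < m` sits inside
    -- the existential so that `w` and `s` are total functions; `z` will supply the new component of
    -- index `m`.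
    have h6 : ∀ j, ∃ w s, j < m → (p : B) ^ j * y j ^ p ^ (m - j) =
        (p : B) ^ j * w ^ p ^ (m + 1 - j) + (p : B) ^ (m + 1) * s := fun j => by
      by_cases hj : j < m
      · obtain ⟨w, t, hw⟩ := h5 (y j) (h3 j hj)
        obtain ⟨s, hs⟩ := pow_mul_pow_eq_add hw hj.le
        refine ⟨w, s, fun _ => ?_⟩
        rw [hs, ← pow_mul, ← pow_succ', show m - j + 1 = m + 1 - j by omega]
      · exact ⟨0, 0, fun h => absurd h hj⟩
    choose w s hws using h6
    obtain ⟨w', t, hw'⟩ := h5 z h4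
    refine ⟨fun j => if j < m then w j else w', ∑ j ∈ Finset.range m, s j + t, ?_⟩
    have h7 : ghostSum p (m + 1) (fun j => if j < m then w j else w') =
        ∑ j ∈ Finset.range m, (p : B) ^ j * w j ^ p ^ (m + 1 - j) + (p : B) ^ m * w' ^ p := by
      rw [ghostSum, Finset.sum_range_succ]
      congr 1
      · exact Finset.sum_congr rfl fun j hj => by simp [Finset.mem_range.1 hj]
      · simp
    rw [hyz, h7, hw', ghostSum,
      Finset.sum_congr rfl fun j hj => hws j (Finset.mem_range.1 hj), Finset.sum_add_distrib,
      ← Finset.mul_sum]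
    ring

end IsFlatThickening

open TensorProduct

/-! ### Reducedness of smooth algebras over a perfect ring -/

section Reduced

theorem isReduced_of_injective_frobenius (p : ℕ) [hp : Fact p.Prime] {R : Type*} [CommRing R]
    [CharP R p] (h : Function.Injective (frobenius R p)) : IsReduced R :=
  (isReduced_iff_pow_one_lt p hp.1.one_lt).2 fun a ha =>
    h (by rw [frobenius_def, ha, map_zero])

/-- If `R / P` and `S / Q` are étale and `ψ : R → S`, lying over an injection `P → Q`, is inverse
to `κ : S → R` up to Frobenius, then `ψ` is injective. -/
theorem injective_of_etale_of_frobenius (p : ℕ) [Fact p.Prime] {P Q R S : Type*} [CommRing P]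
    [CommRing Q] [CommRing R] [CommRing S] [CharP Q p] [Algebra P Q] [Algebra P R]
    [Algebra Q S] [Algebra.Etale P R] [Algebra.Etale Q S] (ψ : R →+* S) (κ : S →+* R)
    (hPQ : Function.Injective (algebraMap P Q))
    (hψ : ∀ a, ψ (algebraMap P R a) = algebraMap Q S (algebraMap P Q a))
    (hκψ : ∀ r, κ (ψ r) = r ^ p)
    (hκ : ∀ q, ∃ a, algebraMap P R a = κ (algebraMap Q S q) ∧ algebraMap P Q a = q ^ p) :
    Function.Injective ψ := by
  rcases subsingleton_or_nontrivial (Q ⊗[P] R) with hsub | hnon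
  · have : Function.Injective (Algebra.TensorProduct.includeRight : R →ₐ[P] Q ⊗[P] R) :=
      Algebra.TensorProduct.includeRight_injective hPQ
    have := this.subsingleton
    exact Function.injective_of_subsingleton _
  have : CharP (Q ⊗[P] R) p := (CharP.charP_iff_prime_eq_zero Fact.out).2 (by
    rw [← map_natCast (algebraMap Q (Q ⊗[P] R)), CharP.cast_eq_zero, map_zero])
  let : Algebra P S := ((algebraMap Q S).comp (algebraMap P Q)).toAlgebra
  have : IsScalarTower P Q S := IsScalarTower.of_algebraMap_eq fun _ => rfl
  let ψ' : R →ₐ[P] S := { ψ with commutes' := hψ }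
  let μ : Q ⊗[P] R →ₐ[Q] S := Algebra.TensorProduct.lift (Algebra.ofId Q S) ψ' fun _ _ =>
    Commute.all _ _
  let lam : S →+* Q ⊗[P] R := (Algebra.TensorProduct.includeRight : R →ₐ[P] Q ⊗[P] R).toRingHom.comp κ
  -- As `lam ∘ μ` is Frobenius, every prime is its own preimage under it. Hence `μ` is surjective on
  -- spectra, and being étale it is faithfully flat, so injective.
  have hlam : ∀ t, lam (μ t) = t ^ p := by
    intro t
    induction t using TensorProduct.induction_on with
    | zero => rw [map_zero, map_zero, zero_pow (Fact.out : p.Prime).ne_zero]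
    | add a b ha hb => rw [map_add, map_add, ha, hb, add_pow_char]
    | tmul q r =>
      obtain ⟨a, ha, hq⟩ := hκ q
      have h1 : μ (q ⊗ₜ r) = algebraMap Q S q * ψ r := rfl
      have h2 : ∀ s, lam s = 1 ⊗ₜ κ s := fun s => rfl
      rw [h1, h2, map_mul, hκψ, ← ha, Algebra.TensorProduct.tmul_pow, ← hq, ← Algebra.smul_def,
        TensorProduct.tmul_smul, TensorProduct.smul_tmul', Algebra.smul_def, mul_one]
  let : Algebra (Q ⊗[P] R) S := μ.toRingHom.toAlgebra
  have : IsScalarTower Q (Q ⊗[P] R) S := IsScalarTower.of_algebraMap_eq fun q => (μ.commutes q).symm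
  have : Algebra.Etale (Q ⊗[P] R) S := Algebra.Etale.of_restrictScalars Q _ _
  have : Module.FaithfullyFlat (Q ⊗[P] R) S := by
    refine Module.FaithfullyFlat.of_comap_surjective fun I => ⟨PrimeSpectrum.comap lam I, ?_⟩
    ext t
    change lam (μ t) ∈ I.asIdeal ↔ t ∈ I.asIdeal
    rw [hlam]
    exact ⟨I.isPrime.mem_of_pow_mem _, fun h => Ideal.pow_mem_of_mem _ h _
      (Fact.out : p.Prime).pos⟩
  have hμ : Function.Injective μ := FaithfulSMul.algebraMap_injective (Q ⊗[P] R) S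
  have h : ∀ r, ψ r = μ (Algebra.TensorProduct.includeRight r) := fun r =>
    (by simp [μ, ψ'] : μ (1 ⊗ₜ r) = ψ r).symm
  intro r r' hr
  exact Algebra.TensorProduct.includeRight_injective hPQ (hμ (by rw [← h, ← h, hr]))

/-- A standard smooth algebra over a perfect ring of characteristic `p` is reduced. -/
theorem isReduced_of_isStandardSmooth (p : ℕ) [Fact p.Prime] (k : Type*) {R : Type*} [CommRing k]
    [CharP k p] [PerfectRing k p] [CommRing R] [CharP R p] [Algebra k R]
    [h : Algebra.IsStandardSmooth k R] : IsReduced R := by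
  obtain ⟨m, g, -, hg⟩ := RingHom.IsStandardSmooth.exists_etale_mvPolynomial
    (f := algebraMap k R) (by rwa [RingHom.isStandardSmooth_algebraMap])
  have : IsReduced k := isReduced_of_injective_frobenius p (PerfectRing.bijective_frobenius (p := p)).1
  let algPR : Algebra (MvPolynomial (Fin m) k) R := g.toAlgebra
  have : Algebra.Etale (MvPolynomial (Fin m) k) R := hg
  -- Here `P → Q` is Frobenius of the polynomial ring, `ψ` is Frobenius of `R` and `κ` is the
  -- identity.
  have key : Function.Injective (frobenius R p) :=
    @injective_of_etale_of_frobenius p _ (MvPolynomial (Fin m) k) (MvPolynomial (Fin m) k) R R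
      _ _ _ _ _ (frobenius (MvPolynomial (Fin m) k) p).toAlgebra algPR algPR this this
      (frobenius R p) (RingHom.id R) (frobenius_inj _ p)
      (fun a => (map_pow g a p).symm) (fun _ => rfl) fun q => ⟨q, rfl, rfl⟩
  exact isReduced_of_injective_frobenius p key

end Reduced

/-! ### Generation by coordinates and `p`-th powers -/

section Generation

/-- Unramifiedness yields an idempotent `1 - t` in the ideal of the diagonal. Since `p`-th powers
come from `C`, every element of that ideal has `p`-th power zero, so `t = 1`. -/
theorem isEpi_of_formallyUnramified_of_pow_mem (p : ℕ) [Fact p.Prime] {C R : Type*} [CommRing C]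
    [CommRing R] [CharP R p] [Algebra C R] [Algebra.FiniteType C R]
    [Algebra.FormallyUnramified C R] (hC : ∀ r : R, r ^ p ∈ (algebraMap C R).range) :
    Algebra.IsEpi C R := by
  obtain ⟨t, ht, ht1⟩ := Algebra.FormallyUnramified.iff_exists_tensorProduct.1
    (inferInstance : Algebra.FormallyUnramified C R)
  rw [Algebra.isEpi_iff_forall_one_tmul_eq]
  rcases subsingleton_or_nontrivial (R ⊗[C] R) with hsub | hnon
  · exact fun _ => Subsingleton.elim _ _
  have : CharP (R ⊗[C] R) p := (CharP.charP_iff_prime_eq_zero Fact.out).2 (by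
    rw [← map_natCast (algebraMap R (R ⊗[C] R)), CharP.cast_eq_zero, map_zero])
  have hI : 1 - t ∈ KaehlerDifferential.ideal C R := by
    rw [KaehlerDifferential.ideal, RingHom.mem_ker, map_sub, ht1, map_one, sub_self]
  have hmul : ∀ y ∈ KaehlerDifferential.ideal C R, y * t = 0 := by
    intro y hy
    rw [← KaehlerDifferential.span_range_eq_ideal] at hy
    induction hy using Submodule.span_induction with
    | mem y hy => obtain ⟨s, rfl⟩ := hy; exact ht s
    | zero => exact zero_mul t
    | add a b _ _ ha hb => rw [add_mul, ha, hb, add_zero]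
    | smul a b _ hb => rw [smul_eq_mul, mul_assoc, hb, mul_zero]
  have hpow : ∀ y ∈ KaehlerDifferential.ideal C R, y ^ p = 0 := by
    intro y hy
    rw [← KaehlerDifferential.span_range_eq_ideal] at hy
    induction hy using Submodule.span_induction with
    | mem y hy =>
      obtain ⟨s, rfl⟩ := hy
      obtain ⟨c, hc⟩ := hC s
      simp only [sub_pow_char, Algebra.TensorProduct.tmul_pow, one_pow, ← hc]
      rw [sub_eq_zero, Algebra.algebraMap_eq_smul_one, TensorProduct.smul_tmul]
    | zero => exact zero_pow (Fact.out : p.Prime).ne_zero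
    | add a b _ _ ha hb => rw [add_pow_char, ha, hb, add_zero]
    | smul a b _ hb => rw [smul_eq_mul, mul_pow, hb, mul_zero]
  have ht2 : t = 1 := by
    have h1 : IsIdempotentElem (1 - t) := by
      have := hmul _ hI
      rw [IsIdempotentElem, mul_sub, mul_one, this, sub_zero]
    have h2 := h1.pow_eq (Fact.out : p.Prime).ne_zero
    rw [hpow _ hI] at h2
    exact (sub_eq_zero.1 h2.symm).symm
  intro a
  have := ht a
  rwa [ht2, mul_one, sub_eq_zero] at this

/-- If the differentials of the `x i` form a basis of `Ω[B⁄A]`, then the reduction `R` of `B` is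
generated by its `p`-th powers and the reductions of the `x i`. -/
theorem closure_eq_top_of_basis_kaehlerDifferential (p : ℕ) [hp : Fact p.Prime] {A B R : Type*}
    [CommRing A] [CommRing B] [CommRing R] [CharP R p] [Algebra A B] [Algebra A R] [Algebra B R]
    [IsScalarTower A B R] [Algebra.FiniteType A B]
    (hBR : Function.Surjective (algebraMap B R))
    (hA : ∀ a, ∃ r, algebraMap A R a = r ^ p) {ι : Type*} (b : Module.Basis ι B (Ω[B⁄A]))
    {x : ι → B} (hb : ∀ i, b i = KaehlerDifferential.D A B (x i)) :
    Subring.closure (Set.range (fun i => algebraMap B R (x i)) ∪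
      Set.range fun a : R => a ^ p) = ⊤ := by
  set s : Set R := Set.range (fun i => algebraMap B R (x i)) ∪ Set.range fun a : R => a ^ p
  let C : Subalgebra A R := Algebra.adjoin A s
  have hs : s ⊆ C := Algebra.subset_adjoin
  have : Algebra.FiniteType A R := Algebra.FiniteType.of_surjective
    (IsScalarTower.toAlgHom A B R) hBR
  have : Algebra.FiniteType C R := Algebra.FiniteType.of_restrictScalars_finiteType A C R
  have hpow : ∀ r : R, r ^ p ∈ (algebraMap C R).range := fun r =>
    ⟨⟨r ^ p, hs (Or.inr ⟨r, rfl⟩)⟩, rfl⟩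
  have : Algebra.IsIntegral C R := ⟨fun r => by
    obtain ⟨c, hc⟩ := hpow r
    exact IsIntegral.of_pow hp.1.pos (hc ▸ isIntegral_algebraMap)⟩
  have : Module.Finite C R := Algebra.IsIntegral.finite
  have : Algebra.FormallyUnramified C R := by
    have h0 : ∀ r, KaehlerDifferential.D C R r = 0 := by
      intro r
      obtain ⟨y, rfl⟩ := hBR r
      have h1 : ∀ ω : Ω[B⁄A], (KaehlerDifferential.map A C B R) ω = 0 := by
        intro ω
        have : KaehlerDifferential.map A C B R = 0 := b.ext fun i => by
          rw [hb, KaehlerDifferential.map_D, LinearMap.zero_apply]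
          exact (KaehlerDifferential.D C R).map_algebraMap ⟨algebraMap B R (x i), hs (Or.inl ⟨i, rfl⟩)⟩
        rw [this, LinearMap.zero_apply]
      rw [← KaehlerDifferential.map_D A C B R, h1]
    refine ⟨subsingleton_of_forall_eq 0 fun ω => ?_⟩
    have : ω ∈ Submodule.span R (Set.range (KaehlerDifferential.D C R)) := by
      rw [KaehlerDifferential.span_range_derivation]; trivial
    induction this using Submodule.span_induction with
    | mem y hy => obtain ⟨r, rfl⟩ := hy; exact h0 r
    | zero => rfl
    | add a b _ _ ha hb => rw [ha, hb, add_zero]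
    | smul a b _ hb => rw [hb, smul_zero]
  -- `R` is finite over `C` (integral and of finite type), and a finite epimorphism is surjective.
  have hepi := isEpi_of_formallyUnramified_of_pow_mem p hpow
  have hsurj := Algebra.isEpi_iff_surjective_algebraMap_of_finite.1 hepi
  rw [eq_top_iff]
  rintro r -
  obtain ⟨⟨c, hc⟩, rfl⟩ := hsurj r
  change c ∈ _
  induction hc using Algebra.adjoin_induction with
  | mem y hy => exact Subring.subset_closure hy
  | algebraMap a =>
    obtain ⟨r, hr⟩ := hA a
    rw [hr]
    exact Subring.subset_closure (Or.inr ⟨r, rfl⟩)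
  | add a b _ _ ha hb => exact add_mem ha hb
  | mul a b _ _ ha hb => exact mul_mem ha hb

end Generation

/-! ### Flat thickenings: truncated Witt vectors and smooth algebras over them -/

section Thickening

namespace TruncatedWittVector

variable (p : ℕ) [hp : Fact p.Prime] (n : ℕ) (k : Type*) [CommRing k] [CharP k p] [PerfectRing k p]

variable {p n k} in
theorem truncate_eq_zero_iff (z : WittVector p k) :
    WittVector.truncate n z = 0 ↔ (p : WittVector p k) ^ n ∣ z := by
  rw [← Ideal.mem_span_singleton, WittVector.mem_span_p_pow_iff_le_coeff_eq_zero,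
    ← RingHom.mem_ker, WittVector.mem_ker_truncate]

theorem cast_pow_eq_zero : (p : TruncatedWittVector p n k) ^ n = 0 := by
  rw [← map_natCast (WittVector.truncate n), ← map_pow, truncate_eq_zero_iff]

theorem isFlatThickening_firstCoeff [NeZero n] :
    IsFlatThickening p n (firstCoeff : TruncatedWittVector p n k →+* k) where
  pow_eq_zero := cast_pow_eq_zero p n k
  dvd_of_pow_mul_eq_zero j hj b hb := by
    obtain ⟨z, rfl⟩ := WittVector.truncate_surjective p n k b
    rw [← map_natCast (WittVector.truncate n), ← map_pow, ← map_mul, truncate_eq_zero_iff] at hb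
    obtain ⟨w, hw⟩ := hb
    have h1 : z = (p : WittVector p k) ^ (n - j) * w := by
      have hn : (p : WittVector p k) ^ n = p ^ j * p ^ (n - j) := by
        rw [← pow_add, Nat.add_sub_cancel' hj]
      rw [hn, mul_assoc] at hw
      have hinj : ∀ (m : ℕ) (v : WittVector p k), (p : WittVector p k) ^ m * v = 0 → v = 0 := by
        intro m
        induction m with
        | zero => intro v hv; simpa using hv
        | succ m ih =>
          intro v hv
          refine WittVector.eq_zero_of_p_mul_eq_zero v (ih _ ?_)
          rw [← hv]; ring
      exact sub_eq_zero.1 (hinj j _ (by rw [mul_sub, hw, sub_self]))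
    rw [h1, map_mul, map_pow, map_natCast]
    exact dvd_mul_right _ _
  surjective a := ⟨mk p fun _ => a, coeff_mk (p := p) (fun _ => a) (0 : Fin n)⟩
  map_eq_zero_iff b := by
    obtain ⟨z, rfl⟩ := WittVector.truncate_surjective p n k b
    change (WittVector.truncate n z).coeff 0 = 0 ↔ _
    rw [WittVector.coeff_truncate]
    constructor
    · intro h
      have := (WittVector.mem_span_p_iff_coeff_zero_eq_zero z).2 h
      obtain ⟨w, rfl⟩ := Ideal.mem_span_singleton.1 this
      rw [map_mul, map_natCast]
      exact dvd_mul_right _ _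
    · rintro ⟨w, hw⟩
      obtain ⟨w, rfl⟩ := WittVector.truncate_surjective p n k w
      have h1 := congrArg (coeff 0) hw
      rw [← map_natCast (WittVector.truncate n), ← map_mul, WittVector.coeff_truncate,
        WittVector.coeff_truncate, mul_comm] at h1
      exact h1.trans (WittVector.mul_charP_coeff_zero w)

end TruncatedWittVector

theorem IsFlatThickening.baseChange {p n : ℕ} {A k B R : Type*} [CommRing A] [CommRing k]
    [CommRing B] [CommRing R] [Algebra A k] [Algebra A B] [Algebra A R] [Algebra k R] [Algebra B R]
    [IsScalarTower A k R] [IsScalarTower A B R] [Algebra.IsPushout A k B R] [Module.Flat A B]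
    (h : IsFlatThickening p n (algebraMap A k)) : IsFlatThickening p n (algebraMap B R) where
  pow_eq_zero := by
    rw [← map_natCast (algebraMap A B), ← map_pow, h.pow_eq_zero, map_zero]
  dvd_of_pow_mul_eq_zero j hj b hb := by
    have h1 : ∑ i : Unit, (fun _ : Unit => (p : A) ^ j) i • (fun _ : Unit => b) i = 0 := by
      simpa [Algebra.smul_def] using hb
    -- Equational criterion for flatness: `b` is a combination of elements `y l` whose coefficients
    -- in `A` are killed by `p ^ j`, hence divisible by `p ^ (n - j)`.
    obtain ⟨m, a, y, hy, ha⟩ := Module.Flat.isTrivialRelation_of_sum_smul_eq_zero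
      (R := A) (M := B) h1
    rw [show b = _ from hy ()]
    refine Finset.dvd_sum fun l _ => ?_
    have h2 := ha l
    simp only [Finset.univ_unique, Finset.sum_singleton] at h2
    obtain ⟨c, hc⟩ := h.dvd_of_pow_mul_eq_zero j hj _ h2
    exact ⟨c • y l, by
      change a () l • y l = _
      rw [hc, Algebra.smul_def, Algebra.smul_def, map_mul, map_pow, map_natCast, mul_assoc]⟩
  surjective r := by
    obtain ⟨t, rfl⟩ := (Algebra.IsPushout.equiv A k B R).surjective r
    induction t using TensorProduct.induction_on with
    | zero => exact ⟨0, by simp⟩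
    | add a b ha hb =>
      obtain ⟨a', ha⟩ := ha
      obtain ⟨b', hb⟩ := hb
      exact ⟨a' + b', by rw [map_add, map_add, ha, hb]⟩
    | tmul c b =>
      obtain ⟨a, rfl⟩ := h.surjective c
      refine ⟨algebraMap A B a * b, ?_⟩
      rw [Algebra.IsPushout.equiv_tmul, map_mul, ← IsScalarTower.algebraMap_apply,
        ← IsScalarTower.algebraMap_apply]
  map_eq_zero_iff b := by
    constructor
    · intro hb
      let f : B →ₐ[A] B ⧸ Ideal.span {(p : B)} := Ideal.Quotient.mkₐ A _
      have hker : ∀ a, a ∈ RingHom.ker (Algebra.ofId A k) → Algebra.ofId A (B ⧸ Ideal.span {(p : B)}) a = 0 := by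
        intro a ha
        obtain ⟨c, rfl⟩ := (h.map_eq_zero_iff a).1 ha
        rw [map_mul, map_natCast, ← map_natCast (Ideal.Quotient.mk (Ideal.span {(p : B)})),
          Ideal.Quotient.eq_zero_iff_mem.2 (Ideal.mem_span_singleton_self _), zero_mul]
      -- The pushout property turns `g` and the quotient map into a map `R → B / p`, so `ker (B →
      -- R)` lies in `pB`.
      let g : k →ₐ[A] B ⧸ Ideal.span {(p : B)} :=
        (Ideal.Quotient.liftₐ _ (Algebra.ofId A _) hker).comp
          (Ideal.quotientKerAlgEquivOfSurjective (f := Algebra.ofId A k) h.surjective).symm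
      have h1 := Algebra.pushoutDesc_right R g f (fun _ _ => Commute.all _ _) b
      rw [hb, map_zero] at h1
      exact Ideal.mem_span_singleton.1 (Ideal.Quotient.eq_zero_iff_mem.1 h1.symm)
    · rintro ⟨c, rfl⟩
      rw [map_mul, map_natCast, ← map_natCast (algebraMap k R), ← map_natCast (algebraMap A k),
        (h.map_eq_zero_iff _).2 dvd_rfl, map_zero, zero_mul]

theorem Algebra.IsStandardSmooth.exists_basis_kaehlerDifferential (A B : Type*) [CommRing A]
    [CommRing B] [Algebra A B] [h : Algebra.IsStandardSmooth A B] :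
    ∃ (ι : Type) (_ : Fintype ι) (x : ι → B) (b : Module.Basis ι B (Ω[B⁄A])),
      ∀ i, b i = KaehlerDifferential.D A B (x i) := by
  obtain ⟨ι, σ, _, _, ⟨P⟩⟩ := h
  exact ⟨_, Fintype.ofFinite _, _, P.basisKaehler, P.basisKaehler_apply⟩

/-- The kernel of the differential and the injectivity of the ghost map for a standard smooth
algebra `B` over a flat thickening `A` of a perfect ring. -/
theorem exists_eq_ghostSum_of_isStandardSmooth (p n : ℕ) [hp : Fact p.Prime] (A k B R : Type*)
    [CommRing A] [CommRing k] [CharP k p] [PerfectRing k p]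
    [CommRing B] [CommRing R] [Algebra A k] [Algebra A B] [Algebra A R] [Algebra k R] [Algebra B R]
    [IsScalarTower A k R] [IsScalarTower A B R] [Algebra.IsPushout A k B R]
    [Algebra.IsStandardSmooth A B] (h : IsFlatThickening p n (algebraMap A k)) :
    (∀ y : ℕ → B, ghostSum p n y = 0 → ∀ m < n, algebraMap B R (y m) = 0) ∧
      ∀ b : B, KaehlerDifferential.D A B b = 0 → ∃ y, b = ghostSum p n y := by
  have hB : IsFlatThickening p n (algebraMap B R) := h.baseChange
  -- The zero ring does not have characteristic `p`. If `R = 0`, then `p` is both a unit and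
  -- nilpotent in `B`, so `B = 0`.
  rcases subsingleton_or_nontrivial R with hR | hR
  · refine ⟨fun _ _ _ _ => Subsingleton.elim _ _, fun b _ => ⟨0, ?_⟩⟩
    obtain ⟨c, hc⟩ := (hB.map_eq_zero_iff 1).1 (Subsingleton.elim _ _)
    have : (1 : B) = 0 := by rw [← one_pow n, hc, mul_pow, hB.pow_eq_zero, zero_mul]
    rw [← mul_one b, this, mul_zero, ghostSum]
    refine (Finset.sum_eq_zero fun j _ => ?_).symm
    rw [← mul_one (_ * _), this, mul_zero]
  have : CharP R p := (CharP.charP_iff_prime_eq_zero Fact.out).2 (by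
    rw [← map_natCast (algebraMap k R), CharP.cast_eq_zero, map_zero])
  have : Algebra.IsStandardSmooth k R :=
    Algebra.IsStandardSmooth.of_algEquiv (Algebra.IsPushout.equiv A k B R)
  have hred : IsReduced R := isReduced_of_isStandardSmooth p k
  refine ⟨fun y hy => hB.map_eq_zero_of_ghostSum_eq_zero hy, fun b hb => ?_⟩
  obtain ⟨ι, _, x, c, hc⟩ := Algebra.IsStandardSmooth.exists_basis_kaehlerDifferential A B
  classical
  -- These are the derivations dual to the basis of differentials; they descend to `R` because `d (p
  -- t) = p d t`.
  let d : ι → Derivation ℤ B B := fun i =>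
    ((c.coord i).compDer (KaehlerDifferential.D A B)).restrictScalars ℤ
  have hd : ∀ i b, d i b = c.coord i (KaehlerDifferential.D A B b) := fun i b => rfl
  have hd0 : ∀ i b, (algebraMap B R).toIntAlgHom b = 0 →
      (algebraMap B R).toIntAlgHom (d i b) = 0 := by
    intro i b hb
    obtain ⟨t, rfl⟩ := (hB.map_eq_zero_iff b).1 hb
    change algebraMap B R _ = 0
    rw [(d i).leibniz, (d i).map_natCast, smul_zero, add_zero, smul_eq_mul, map_mul,
      (hB.map_eq_zero_iff _).2 dvd_rfl, zero_mul]
  let D : ι → Derivation ℤ R R := fun i =>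
    Derivation.liftOfSurjective (f := (algebraMap B R).toIntAlgHom) hB.surjective (hd0 i)
  have hD : ∀ i b, algebraMap B R (d i b) = D i (algebraMap B R b) := fun i b =>
    (Derivation.liftOfSurjective_apply (f := (algebraMap B R).toIntAlgHom) hB.surjective
      (hd0 i) b).symm
  have hcoord : IsPCoordinates p (fun i => algebraMap B R (x i)) D := by
    refine ⟨fun i j => ?_, ?_⟩
    · rw [← hD, hd, ← hc, Module.Basis.coord_apply, Module.Basis.repr_self,
        Finsupp.single_apply]
      simp only [eq_comm (a := j)]
      split
      · exact map_one _
      · exact map_zero _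
    · refine closure_eq_top_of_basis_kaehlerDifferential (A := A) p hB.surjective (fun a => ?_) c hc
      obtain ⟨r, hr⟩ := (PerfectRing.bijective_frobenius (p := p)).2 (algebraMap A k a)
      exact ⟨algebraMap k R r, by rw [IsScalarTower.algebraMap_apply A k R, ← hr, map_pow]⟩
  exact hB.exists_eq_ghostSum hcoord hD fun i => by rw [hd, hb, map_zero]

end Thickening

/-! ### Local sections of schemes -/

namespace AlgebraicGeometry

/-- Restriction of sections. -/
def Scheme.res {X : Scheme.{u}} {V U : X.Opens} (h : V ≤ U) : Γ(X, U) →+* Γ(X, V) :=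
  (X.presheaf.map (homOfLE h).op).hom

namespace Scheme

variable {X Y : Scheme.{u}}

theorem res_res {U V W : X.Opens} (h : V ≤ U) (h' : W ≤ V) (s : Γ(X, U)) :
    res h' (res h s) = res (h'.trans h) s := by
  simp only [res, ← CommRingCat.comp_apply, ← X.presheaf.map_comp]
  rfl

theorem res_self {U : X.Opens} (h : U ≤ U) (s : Γ(X, U)) : res h s = s := by
  change X.presheaf.map (𝟙 (op U)) s = s
  rw [X.presheaf.map_id]
  rfl

theorem app_res (i : X ⟶ Y) {U V : Y.Opens} (h : V ≤ U) (s : Γ(Y, U)) :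
    i.app V (res h s) = res (i.preimage_mono h) (i.app U s) :=
  congr($(i.naturality (homOfLE h).op) s)

theorem eq_of_res_eq {U : X.Opens} {s t : Γ(X, U)}
    (H : ∀ x ∈ U, ∃ (V : X.Opens) (h : V ≤ U), x ∈ V ∧ res h s = res h t) : s = t :=
  X.IsSheaf.section_ext fun x hx => by
    obtain ⟨V, h, hxV, hV⟩ := H x hx
    exact ⟨V, h, hxV, hV⟩

theorem exists_res_eq {ι : Type u} {U : X.Opens} {V : ι → X.Opens} (hV : ∀ i, V i ≤ U)
    (hcover : ∀ x ∈ U, ∃ i, x ∈ V i) (sf : ∀ i, Γ(X, V i))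
    (h : ∀ i j, res (inf_le_left : V i ⊓ V j ≤ V i) (sf i) =
      res (inf_le_right : V i ⊓ V j ≤ V j) (sf j)) : ∃ s : Γ(X, U), ∀ i, res (hV i) s = sf i :=
  (X.sheaf.existsUnique_gluing' V U (fun i => homOfLE (hV i))
    (fun x hx => Opens.mem_iSup.2 (hcover x hx)) sf h).exists

theorem exists_isAffineOpen_mem_le {U : X.Opens} {x : X} (hx : x ∈ U) :
    ∃ V : X.Opens, IsAffineOpen V ∧ x ∈ V ∧ V ≤ U := by
  obtain ⟨V, hV, hxV, hVU⟩ := X.isBasis_affineOpens.exists_subset_of_mem_open hx U.isOpen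
  exact ⟨⟨V, X.isBasis_affineOpens.isOpen hV⟩, by obtain ⟨W, hW, rfl⟩ := hV; exact hW, hxV, hVU⟩

end Scheme

/-! ### Locality of the de Rham differential -/

section Differentials

variable {R : Type u} [CommRing R] {X : Scheme.{u}} (f : X ⟶ Spec (CommRingCat.of R))

theorem res_algMap {U V : X.Opens} (h : V ≤ U) (a : R) :
    Scheme.res h (algMap f U a) = algMap f V a :=
  congr($((structureMap f).naturality (homOfLE h).op) a).symm

/-- `s` is killed by the universal derivation of the `R`-algebra `Γ(X, U)`. -/
def IsClosedSection (U : X.Opens) (s : Γ(X, U)) : Prop :=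
  letI := (algMap f U).toAlgebra
  KaehlerDifferential.D R Γ(X, U) s = 0

theorem isClosedSection_iff (U : X.Opens) (s : Γ(X, U)) : IsClosedSection f U s ↔
    (PresheafOfModules.DifferentialsConstruction.derivation' (structureMap f)).d
      (X := op U) s = 0 := Iff.rfl

theorem presheaf_map_d {U V : X.Opens} (h : V ≤ U) (s : Γ(X, U)) :
    (kaehlerPresheaf f).presheaf.map (homOfLE h).op
      ((PresheafOfModules.DifferentialsConstruction.derivation' (structureMap f)).d
        (X := op U) s) =
      (PresheafOfModules.DifferentialsConstruction.derivation' (structureMap f)).d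
        (X := op V) (Scheme.res h s) :=
  ((PresheafOfModules.DifferentialsConstruction.derivation' (structureMap f)).d_map
    (homOfLE h).op s).symm

theorem IsClosedSection.res {U V : X.Opens} (h : V ≤ U) {s : Γ(X, U)}
    (hs : IsClosedSection f U s) : IsClosedSection f V (Scheme.res h s) := by
  rw [isClosedSection_iff] at hs ⊢
  rw [← presheaf_map_d, hs]
  exact map_zero _

/-- The de Rham differential of `s` vanishes if and only if `s` is locally killed by the
universal derivations. -/
theorem deRhamD_eq_zero_iff (U : X.Opens) (s : Γ(X, U)) : deRhamD f U s = 0 ↔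
    ∀ x ∈ U, ∃ (V : X.Opens) (h : V ≤ U), x ∈ V ∧ IsClosedSection f V (Scheme.res h s) := by
  set ω : (kaehlerPresheaf f).presheaf.obj (op U) :=
    (PresheafOfModules.DifferentialsConstruction.derivation' (structureMap f)).d (X := op U) s
    with hω
  have hD : deRhamD f U s =
      (CategoryTheory.toSheafify (Opens.grothendieckTopology X)
        (kaehlerPresheaf f).presheaf).app (op U) ω := rfl
  constructor
  · intro h x hx
    -- The map to the sheafification is locally injective.
    have hmem := Presheaf.equalizerSieve_mem (Opens.grothendieckTopology X)
      (CategoryTheory.toSheafify (Opens.grothendieckTopology X) (kaehlerPresheaf f).presheaf)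
      ω 0 (by rw [← hD, h]; exact (map_zero _).symm)
    obtain ⟨V, i, hi, hxV⟩ := hmem x hx
    refine ⟨V, leOfHom i, hxV, ?_⟩
    rw [isClosedSection_iff, ← presheaf_map_d]
    exact hi.trans (map_zero _)
  · intro h
    refine TopCat.Presheaf.section_ext
      ((SheafOfModules.toSheaf _).obj (kaehlerSheaf f)) U (deRhamD f U s) 0 fun x hx => ?_
    obtain ⟨V, hVU, hxV, hV⟩ := h x hx
    refine TopCat.Presheaf.germ_ext _ V hxV (homOfLE hVU) (homOfLE hVU) ?_
    have h1 := congr($((CategoryTheory.toSheafify (Opens.grothendieckTopology X)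
      (kaehlerPresheaf f).presheaf).naturality (homOfLE hVU).op) ω)
    have h2 := presheaf_map_d f hVU s
    rw [(isClosedSection_iff f V _).1 hV] at h2
    refine h1.symm.trans ?_
    refine (congrArg ((CategoryTheory.toSheafify (Opens.grothendieckTopology X)
      (kaehlerPresheaf f).presheaf).app (op V)) h2).trans ?_
    exact (map_zero _).trans (map_zero _).symm

end Differentials

/-! ### Standard smooth charts -/

section Smooth

variable {R : Type u} [CommRing R] {X : Scheme.{u}} (f : X ⟶ Spec (CommRingCat.of R))

theorem ofHom_algMap_eq (U : X.Opens) : CommRingCat.ofHom (algMap f U) =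
    (Scheme.ΓSpecIso (CommRingCat.of R)).inv ≫ f.appLE ⊤ U le_top := by
  rfl

variable [Smooth f]

theorem smooth_algMap {U : X.Opens} (hU : IsAffineOpen U) : (algMap f U).Smooth := by
  have h := f.smooth_appLE (isAffineOpen_top _) hU le_top
  exact RingHom.Smooth.comp (f := (Scheme.ΓSpecIso (CommRingCat.of R)).inv.hom)
    (RingHom.Smooth.of_bijective
      ((Scheme.ΓSpecIso (CommRingCat.of R)).symm.commRingCatIsoToRingEquiv.bijective)) h

theorem exists_isStandardSmooth_algMap {U : X.Opens} {x : X} (hx : x ∈ U) :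
    ∃ V : X.Opens, IsAffineOpen V ∧ x ∈ V ∧ V ≤ U ∧ (algMap f V).IsStandardSmooth := by
  obtain ⟨W, hW, hxW, hWU⟩ := Scheme.exists_isAffineOpen_mem_le hx
  let : Algebra R Γ(X, W) := (algMap f W).toAlgebra
  have : Algebra.Smooth R Γ(X, W) := smooth_algMap f hW
  obtain ⟨s, hs, hst⟩ := Algebra.Smooth.exists_span_eq_top_isStandardSmooth R Γ(X, W)
  have hxs := hW.self_le_iSup_basicOpen_iff.2 hs hxW
  obtain ⟨⟨g, hg⟩, hxg⟩ := Opens.mem_iSup.1 hxs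
  refine ⟨X.basicOpen g, hW.basicOpen g, hxg, (X.basicOpen_le g).trans hWU, ?_⟩
  have hloc := hW.isLocalization_basicOpen g
  let : Algebra R Γ(X, X.basicOpen g) := (algMap f (X.basicOpen g)).toAlgebra
  have : IsScalarTower R Γ(X, W) Γ(X, X.basicOpen g) :=
    IsScalarTower.of_algebraMap_eq fun a => (res_algMap f (X.basicOpen_le g) a).symm
  have := hst g hg
  exact Algebra.IsStandardSmooth.of_algEquiv
    ((IsLocalization.algEquiv (Submonoid.powers g) (Localization.Away g)
      Γ(X, X.basicOpen g)).restrictScalars R)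

end Smooth

/-! ### Base change on affine opens -/

section BaseChange

variable {A k : Type u} [CommRing A] [CommRing k] (π : A →+* k) {X X' : Scheme.{u}}
  (f : X ⟶ Spec (CommRingCat.of k)) (f' : X' ⟶ Spec (CommRingCat.of A)) (i : X ⟶ X')
  (hi : IsPullback i f f' (Spec.map (CommRingCat.ofHom π)))

include hi

theorem algMap_comp_app (U : X'.Opens) : CommRingCat.ofHom (algMap f' U) ≫ i.app U =
    CommRingCat.ofHom π ≫ CommRingCat.ofHom (algMap f (i ⁻¹ᵁ U)) := by
  have h1 : f'.appLE ⊤ U le_top ≫ i.app U =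
      (Spec.map (CommRingCat.ofHom π)).appTop ≫ f.appLE ⊤ (i ⁻¹ᵁ U) le_top := by
    have h2 : f'.appLE ⊤ U le_top ≫ i.appLE U (i ⁻¹ᵁ U) le_rfl =
        (i ≫ f').appLE ⊤ (i ⁻¹ᵁ U) le_top := Scheme.Hom.appLE_comp_appLE ..
    have h3 : (Spec.map (CommRingCat.ofHom π)).appLE ⊤ ⊤ le_top ≫ f.appLE ⊤ (i ⁻¹ᵁ U) le_top =
        (f ≫ Spec.map (CommRingCat.ofHom π)).appLE ⊤ (i ⁻¹ᵁ U) le_top :=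
      Scheme.Hom.appLE_comp_appLE ..
    rw [Scheme.Hom.appLE_eq_app] at h2
    have h4 : (Spec.map (CommRingCat.ofHom π)).appLE ⊤ ⊤ le_top =
      (Spec.map (CommRingCat.ofHom π)).appTop := Scheme.Hom.appLE_eq_app _
    rw [h2, ← h4, h3]
    congr 1
    exact hi.w
  rw [ofHom_algMap_eq, ofHom_algMap_eq, Category.assoc, h1,
    ← Category.assoc, ← Category.assoc, Scheme.ΓSpecIso_inv_naturality]

theorem app_algMap (U : X'.Opens) (a : A) :
    i.app U (algMap f' U a) = algMap f (i ⁻¹ᵁ U) (π a) :=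
  congr($(algMap_comp_app π f f' i hi U) a)

theorem isPushout_algMap {U : X'.Opens} (hU : IsAffineOpen U) :
    IsPushout (CommRingCat.ofHom π) (CommRingCat.ofHom (algMap f' U))
      (CommRingCat.ofHom (algMap f (i ⁻¹ᵁ U))) (i.app U) := by
  have h1 := (isIso_pushoutSection_iff hi (US := ⊤) (UT := ⊤) (UX := U) le_top le_top
    (UY := i ⁻¹ᵁ U) (by simp)).1 (isIso_pushoutSection_of_isAffineOpen hi _ _ _
      (isAffineOpen_top _) (isAffineOpen_top _) hU)
  refine h1.flip.of_iso (Scheme.ΓSpecIso _) (Scheme.ΓSpecIso _) (Iso.refl _) (Iso.refl _) ?_ ?_ ?_ ?_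
  · rw [← Scheme.ΓSpecIso_naturality]
    congr 1
  · rw [ofHom_algMap_eq, Iso.hom_inv_id_assoc]
    exact Category.comp_id _
  · rw [ofHom_algMap_eq, Iso.hom_inv_id_assoc]
    exact Category.comp_id _
  · rw [Scheme.Hom.appLE_eq_app]
    exact (Category.comp_id _).trans (Category.id_comp _).symm

end BaseChange

end AlgebraicGeometry

/-! ### The ghost component as a morphism of sheaves -/

namespace AlgebraicGeometry

variable {p : ℕ} [Fact p.Prime] {n : ℕ}

section Lift

variable {X X' : Scheme.{u}} (i : X ⟶ X')

/-- Restriction of sections of `W_n 𝒪_X`. -/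
def wittRes {U V : X'.Opens} (h : V ≤ U) :
    TruncatedWittVector p n Γ(X, i ⁻¹ᵁ U) →+* TruncatedWittVector p n Γ(X, i ⁻¹ᵁ V) :=
  TruncatedWittVector.map (Scheme.res (i.preimage_mono h))

theorem wittRes_res {U V W : X'.Opens} (h : V ≤ U) (h' : W ≤ V)
    (x : TruncatedWittVector p n Γ(X, i ⁻¹ᵁ U)) :
    wittRes i h' (wittRes i h x) = wittRes i (h'.trans h) x := by
  ext j
  exact Scheme.res_res _ _ _

theorem wittRes_self {U : X'.Opens} (h : U ≤ U) (x : TruncatedWittVector p n Γ(X, i ⁻¹ᵁ U)) :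
    wittRes i h x = x := by
  ext j
  exact Scheme.res_self _ _

variable (p n) in
/-- Reduction of Witt vectors of sections of `𝒪_{X'}`. -/
def wittReduction (U : X'.Opens) :
    WittVector p Γ(X', U) →+* TruncatedWittVector p n Γ(X, i ⁻¹ᵁ U) :=
  (WittVector.truncate n).comp (WittVector.map (i.app U).hom)

theorem coeff_wittReduction {U : X'.Opens} (z : WittVector p Γ(X', U)) (j : Fin n) :
    (wittReduction p n i U z).coeff j = i.app U (z.coeff j) := by
  simp [wittReduction, WittVector.coeff_truncate, WittVector.map_coeff]

theorem wittReduction_map_res {U V : X'.Opens} (h : V ≤ U) (z : WittVector p Γ(X', U)) :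
    wittReduction p n i V (WittVector.map (Scheme.res h) z) =
      wittRes i h (wittReduction p n i U z) := by
  ext j
  rw [coeff_wittReduction, WittVector.map_coeff, Scheme.app_res, ← coeff_wittReduction]
  rfl

theorem wittReduction_surjective {U : X'.Opens} (h : Function.Surjective (i.app U)) :
    Function.Surjective (wittReduction p n i U) := by
  intro x
  choose y hy using fun j => h (x.coeff j)
  refine ⟨WittVector.mk p fun j => if h : j < n then y ⟨j, h⟩ else 0, ?_⟩
  ext j
  rw [coeff_wittReduction, WittVector.coeff_mk]
  simp [hy]

theorem res_ghostComponent {U V : X'.Opens} (h : V ≤ U) (z : WittVector p Γ(X', U)) :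
    Scheme.res h (WittVector.ghostComponent n z) =
      WittVector.ghostComponent n (WittVector.map (Scheme.res h) z) := by
  simp [WittVector.ghostComponent_apply, wittPolynomial_eq_sum_C_mul_X_pow]

end Lift

variable (p n) in
/-- The properties of a lifting `i : X ⟶ X'` that hold over the affine open subsets of `X'`. -/
structure IsFlatLift {X X' : Scheme.{u}} (i : X ⟶ X') : Prop where
  isFlatThickening : ∀ {U : X'.Opens}, IsAffineOpen U → IsFlatThickening p n (i.app U).hom

namespace IsFlatLift

variable {X X' : Scheme.{u}} {i : X ⟶ X'} (hL : IsFlatLift p n i)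

include hL

omit [Fact p.Prime] in
theorem cast_pow_eq_zero (U : X'.Opens) : (p : Γ(X', U)) ^ n = 0 := by
  refine Scheme.eq_of_res_eq fun x hx => ?_
  obtain ⟨V, hV, hxV, hVU⟩ := Scheme.exists_isAffineOpen_mem_le hx
  exact ⟨V, hVU, hxV, by rw [map_pow, map_natCast, (hL.isFlatThickening hV).pow_eq_zero, map_zero]⟩

/-- The kernel of reduction is known to be generated by `p` only over affines, so the comparison is
made there. -/
theorem ghostComponent_congr {U : X'.Opens} {z z' : WittVector p Γ(X', U)}
    (h : wittReduction p n i U z = wittReduction p n i U z') :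
    WittVector.ghostComponent n z = WittVector.ghostComponent n z' := by
  refine Scheme.eq_of_res_eq fun x hx => ?_
  obtain ⟨V, hV, hxV, hVU⟩ := Scheme.exists_isAffineOpen_mem_le hx
  refine ⟨V, hVU, hxV, ?_⟩
  rw [res_ghostComponent, res_ghostComponent, ← ghostSum_coeff (hL.cast_pow_eq_zero V),
    ← ghostSum_coeff (hL.cast_pow_eq_zero V)]
  refine ghostSum_congr (hL.cast_pow_eq_zero V) fun j hj => ?_
  rw [← (hL.isFlatThickening hV).map_eq_zero_iff, map_sub, sub_eq_zero]
  have h1 := congrArg (fun w => (wittRes i hVU w).coeff ⟨j, hj⟩) h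
  simp only [← wittReduction_map_res] at h1
  rwa [coeff_wittReduction, coeff_wittReduction] at h1

/-- Lifts exist over affine opens, and independence of the lift makes their ghost components agree
on overlaps and glue. Testing against all opens `V` builds in compatibility with restriction. -/
theorem existsUnique_value {U : X'.Opens} (x : TruncatedWittVector p n Γ(X, i ⁻¹ᵁ U)) :
    ∃! s : Γ(X', U), ∀ (V : X'.Opens) (h : V ≤ U) (z : WittVector p Γ(X', V)),
      wittReduction p n i V z = wittRes i h x →
        Scheme.res h s = WittVector.ghostComponent n z := by
  let ι := {V : X'.Opens // IsAffineOpen V ∧ V ≤ U}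
  have hz : ∀ V : ι, ∃ z : WittVector p Γ(X', V.1), wittReduction p n i V.1 z = wittRes i V.2.2 x :=
    fun V => wittReduction_surjective i (hL.isFlatThickening V.2.1).surjective _
  choose z hz using hz
  obtain ⟨s, hs⟩ := Scheme.exists_res_eq (fun V : ι => V.2.2) (fun x hx => by
      obtain ⟨V, hV, hxV, hVU⟩ := Scheme.exists_isAffineOpen_mem_le hx
      exact ⟨⟨V, hV, hVU⟩, hxV⟩)
    (fun V => WittVector.ghostComponent n (z V)) (fun V W => by
      simp only [res_ghostComponent]
      apply hL.ghostComponent_congr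
      rw [wittReduction_map_res, wittReduction_map_res, hz, hz, wittRes_res, wittRes_res])
  refine ⟨s, fun V h w hw => ?_, fun t ht => ?_⟩
  · refine Scheme.eq_of_res_eq fun y hy => ?_
    obtain ⟨W, hW, hyW, hWV⟩ := Scheme.exists_isAffineOpen_mem_le hy
    refine ⟨W, hWV, hyW, ?_⟩
    rw [Scheme.res_res, hs ⟨W, hW, hWV.trans h⟩, res_ghostComponent]
    apply hL.ghostComponent_congr
    rw [wittReduction_map_res, hw, hz, wittRes_res]
  · refine Scheme.eq_of_res_eq fun y hy => ?_
    obtain ⟨W, hW, hyW, hWU⟩ := Scheme.exists_isAffineOpen_mem_le hy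
    exact ⟨W, hWU, hyW, by rw [ht W hWU _ (hz ⟨W, hW, hWU⟩), hs ⟨W, hW, hWU⟩]⟩

/-- The map `W_n(Γ(X, i⁻¹ U)) → Γ(X', U)` induced by the ghost component `w_n`. -/
def ghost {U : X'.Opens} (x : TruncatedWittVector p n Γ(X, i ⁻¹ᵁ U)) : Γ(X', U) :=
  (hL.existsUnique_value x).choose

theorem res_ghost_eq {U V : X'.Opens} (h : V ≤ U) {x : TruncatedWittVector p n Γ(X, i ⁻¹ᵁ U)}
    {z : WittVector p Γ(X', V)} (hz : wittReduction p n i V z = wittRes i h x) :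
    Scheme.res h (hL.ghost x) = WittVector.ghostComponent n z :=
  (hL.existsUnique_value x).choose_spec.1 V h z hz

theorem ghost_wittReduction {U : X'.Opens} (z : WittVector p Γ(X', U)) :
    hL.ghost (wittReduction p n i U z) = WittVector.ghostComponent n z := by
  rw [← hL.res_ghost_eq le_rfl (wittRes_self i _ _).symm, Scheme.res_self]

theorem res_ghost {U V : X'.Opens} (h : V ≤ U) (x : TruncatedWittVector p n Γ(X, i ⁻¹ᵁ U)) :
    Scheme.res h (hL.ghost x) = hL.ghost (wittRes i h x) := by
  refine (hL.existsUnique_value (wittRes i h x)).unique (fun W hW z hz => ?_)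
    fun W hW z hz => hL.res_ghost_eq hW hz
  rw [Scheme.res_res]
  exact hL.res_ghost_eq _ (by rw [hz, wittRes_res])

theorem exists_wittReduction_eq {U : X'.Opens} (hU : IsAffineOpen U)
    (x : TruncatedWittVector p n Γ(X, i ⁻¹ᵁ U)) : ∃ z, wittReduction p n i U z = x :=
  wittReduction_surjective i (hL.isFlatThickening hU).surjective x

/-- `IsFlatLift.ghost` as a ring homomorphism. -/
def ghostHom (U : X'.Opens) : TruncatedWittVector p n Γ(X, i ⁻¹ᵁ U) →+* Γ(X', U) where
  toFun := hL.ghost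
  map_one' := by
    rw [← map_one (wittReduction p n i U), hL.ghost_wittReduction, map_one]
  map_zero' := by
    rw [← map_zero (wittReduction p n i U), hL.ghost_wittReduction, map_zero]
  map_mul' x y := by
    refine Scheme.eq_of_res_eq fun a ha => ?_
    obtain ⟨V, hV, haV, hVU⟩ := Scheme.exists_isAffineOpen_mem_le ha
    obtain ⟨z, hz⟩ := hL.exists_wittReduction_eq hV (wittRes i hVU x)
    obtain ⟨w, hw⟩ := hL.exists_wittReduction_eq hV (wittRes i hVU y)
    refine ⟨V, hVU, haV, ?_⟩
    rw [map_mul, hL.res_ghost, hL.res_ghost, hL.res_ghost, map_mul, ← hz, ← hw, ← map_mul,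
      hL.ghost_wittReduction, hL.ghost_wittReduction, hL.ghost_wittReduction, map_mul]
  map_add' x y := by
    refine Scheme.eq_of_res_eq fun a ha => ?_
    obtain ⟨V, hV, haV, hVU⟩ := Scheme.exists_isAffineOpen_mem_le ha
    obtain ⟨z, hz⟩ := hL.exists_wittReduction_eq hV (wittRes i hVU x)
    obtain ⟨w, hw⟩ := hL.exists_wittReduction_eq hV (wittRes i hVU y)
    refine ⟨V, hVU, haV, ?_⟩
    rw [map_add, hL.res_ghost, hL.res_ghost, hL.res_ghost, map_add, ← hz, ← hw, ← map_add,
      hL.ghost_wittReduction, hL.ghost_wittReduction, hL.ghost_wittReduction, map_add]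

/-- The morphism of sheaves of rings `W_n 𝒪_X → 𝒪_{X'}` induced by the ghost component `w_n`. -/
def ghostSheafHom : wittSheafOn p n i ⟶ X'.sheaf :=
  ⟨{ app := fun U => CommRingCat.ofHom (hL.ghostHom U.unop)
     naturality := fun U V g => by
      ext x
      exact (hL.res_ghost (leOfHom g.unop) x).symm }⟩

theorem onSections_ghostSheafHom (U : X'.Opens) :
    onSections hL.ghostSheafHom U = hL.ghostHom U := rfl

theorem ghost_eq_sum {U : X'.Opens} {x : TruncatedWittVector p n Γ(X, i ⁻¹ᵁ U)}
    {y : Fin n → Γ(X', U)} (hy : ∀ j, i.app U (y j) = x.coeff j) :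
    hL.ghost x = ∑ j : Fin n, (p : Γ(X', U)) ^ (j : ℕ) * y j ^ p ^ (n - (j : ℕ)) := by
  have hx : x = wittReduction p n i U
      (WittVector.mk p fun j => if h : j < n then y ⟨j, h⟩ else 0) := by
    ext j
    rw [coeff_wittReduction, WittVector.coeff_mk]
    simp [hy]
  rw [hx, hL.ghost_wittReduction, ← ghostSum_coeff (hL.cast_pow_eq_zero U), ghostSum_eq_sum_fin]
  simp

theorem isTildeF_ghostSheafHom :
    IsTildeF p n i (Functor.whiskerRight hL.ghostSheafHom.hom (forget CommRingCat.{u})) :=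
  fun _ _ _ hy => hL.ghost_eq_sum hy

/-- Naturality reduces uniqueness to affine opens, where all components lift and the formula
dictates the value. -/
theorem existsUnique_isTildeF : ∃! φ, IsTildeF p n i φ := by
  refine ⟨_, hL.isTildeF_ghostSheafHom, fun φ hφ => ?_⟩
  ext U x
  refine Scheme.eq_of_res_eq (U := U.unop) fun a ha => ?_
  obtain ⟨V, hV, haV, hVU⟩ := Scheme.exists_isAffineOpen_mem_le ha
  refine ⟨V, hVU, haV, ?_⟩
  choose y hy using fun j : Fin n => (hL.isFlatThickening hV).surjective
    (TruncatedWittVector.coeff (p := p) j (wittRes i hVU x))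
  have h1 : Scheme.res hVU (φ.app U x) = φ.app (op V) (wittRes i hVU x) :=
    congr($(φ.naturality (homOfLE hVU).op) x).symm
  refine h1.trans ((hφ V (wittRes i hVU x) y hy).trans ?_)
  rw [← hL.ghost_eq_sum hy]
  exact (hL.res_ghost hVU x).symm

end IsFlatLift

end AlgebraicGeometry

/-! ### Iterated Frobenius on `W_n(k)` -/

namespace TruncatedWittVector

variable {p : ℕ} [Fact p.Prime] {n : ℕ} {k : Type*} [CommRing k] [CharP k p]

theorem iterate_frobeniusMap_truncate_teichmuller (m : ℕ) (c : k) :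
    (frobeniusMap p n k)^[m] (WittVector.truncate n (WittVector.teichmuller p c)) =
      WittVector.truncate n (WittVector.teichmuller p c) ^ p ^ m := by
  induction m with
  | zero => simp
  | succ m ih =>
    rw [Function.iterate_succ_apply', ih, map_pow, frobeniusMap_truncate,
      WittVector.frobenius_eq_map_frobenius, WittVector.map_teichmuller, frobenius_def, map_pow,
      map_pow, ← pow_mul, pow_succ']

/-- The `n`-th power of Frobenius in terms of the ghost component `w_n`. -/
theorem iterate_frobeniusMap_eq_sum [PerfectRing k p] (a : TruncatedWittVector p n k) :
    (frobeniusMap p n k)^[n] a = ∑ j : Fin n, (p : TruncatedWittVector p n k) ^ (j : ℕ) *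
      WittVector.truncate n (WittVector.teichmuller p (a.coeff j)) ^ p ^ (n - (j : ℕ)) := by
  obtain ⟨z, rfl⟩ := WittVector.truncate_surjective p n k a
  cases n with
  | zero => ext j; exact j.elim0
  | succ m =>
    -- The Teichmüller expansion `z = ∑ p ^ j [z_j ^ (1 / p ^ j)]` modulo `p ^ (m + 1)`. Applying
    -- `Φ^(m + 1)` raises each representative to the power `p ^ (m + 1)`, of which `p ^ j` cancels
    -- the root.
    have h1 := (truncate_eq_zero_iff _).2
      (WittVector.dvd_sub_sum_teichmuller_iterateFrobeniusEquiv_coeff z m)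
    rw [map_sub, sub_eq_zero] at h1
    have hroot : ∀ (j : ℕ) (c : k), (((frobeniusEquiv k p).symm ^ j) c) ^ p ^ j = c := by
      intro j
      induction j with
      | zero => intro c; simp
      | succ j ih =>
        intro c
        rw [pow_succ', pow_succ, pow_mul]
        change (((frobeniusEquiv k p).symm (((frobeniusEquiv k p).symm ^ j) c)) ^ p ^ j) ^ p = c
        rw [← pow_mul, mul_comm, pow_mul, frobeniusEquiv_symm_pow_p, ih]
    have hG : ∀ w, (frobeniusMap p (m + 1) k)^[m + 1] w = (frobeniusMap p (m + 1) k ^ (m + 1)) w :=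
      fun w => by rw [RingHom.coe_pow]
    conv_lhs => rw [h1]
    rw [hG, map_sum, map_sum, ← Nat.range_succ_eq_Iic, Finset.sum_range]
    have hterm : ∀ (j : ℕ) (hj : j ≤ m + 1) (c : k),
        (frobeniusMap p (m + 1) k)^[m + 1] (WittVector.truncate (m + 1)
          (WittVector.teichmuller p (((frobeniusEquiv k p).symm ^ j) c))) =
        WittVector.truncate (m + 1) (WittVector.teichmuller p c) ^ p ^ (m + 1 - j) := by
      intro j hj c
      have hp : p ^ (m + 1) = p ^ j * p ^ (m + 1 - j) := by
        rw [← pow_add, Nat.add_sub_cancel' hj]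
      have hc : WittVector.truncate (m + 1)
          (WittVector.teichmuller p (((frobeniusEquiv k p).symm ^ j) c)) ^ p ^ j =
          WittVector.truncate (m + 1) (WittVector.teichmuller p c) := by
        rw [← map_pow, ← map_pow, hroot]
      rw [iterate_frobeniusMap_truncate_teichmuller, hp, pow_mul, hc]
    refine Finset.sum_congr rfl fun j _ => ?_
    rw [map_mul, map_mul, ← hG, hterm j j.2.le, map_pow, map_natCast,
      map_pow, map_natCast, mul_comm, WittVector.coeff_truncate]

omit [CharP k p] in
theorem firstCoeff_truncate_teichmuller [NeZero n] (c : k) :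
    firstCoeff (WittVector.truncate n (WittVector.teichmuller p c)) = c := by
  change (WittVector.truncate n (WittVector.teichmuller p c)).coeff 0 = c
  rw [WittVector.coeff_truncate]
  exact WittVector.teichmuller_coeff_zero p c

end TruncatedWittVector

/-! ### The homeomorphism and the image of the ghost map -/

namespace AlgebraicGeometry

/-- A surjection with nil kernel gives a surjective closed immersion of spectra, and both properties
survive base change. -/
theorem isHomeomorph_of_isPullback {A k : Type u} [CommRing A] [CommRing k] {π : A →+* k}
    (hπ : Function.Surjective π) (hker : ∀ a, π a = 0 → IsNilpotent a) {X X' : Scheme.{u}}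
    {f : X ⟶ Spec (CommRingCat.of k)} {f' : X' ⟶ Spec (CommRingCat.of A)} {i : X ⟶ X'}
    (hi : IsPullback i f f' (Spec.map (CommRingCat.ofHom π))) : IsHomeomorph i := by
  have h1 : IsClosedImmersion (Spec.map (CommRingCat.ofHom π)) :=
    IsClosedImmersion.spec_of_surjective _ hπ
  have h2 : Surjective (Spec.map (CommRingCat.ofHom π)) := by
    refine ⟨fun x => ?_⟩
    have H : ∀ y : PrimeSpectrum A, y ∈ Set.range (PrimeSpectrum.comap π) := fun y => by
      rw [range_comap_of_surjective _ _ hπ, PrimeSpectrum.mem_zeroLocus]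
      exact fun a ha => nilpotent_iff_mem_prime.1 (hker a ha) _ y.isPrime
    exact H x
  have h3 : IsClosedImmersion i := MorphismProperty.of_isPullback hi.flip h1
  have h4 : Surjective i := MorphismProperty.of_isPullback hi.flip h2
  exact isHomeomorph_iff_isEmbedding_surjective.mpr ⟨i.isEmbedding, h4.surj⟩

section Main

variable {p : ℕ} [Fact p.Prime] {n : ℕ} [NeZero n] {k : Type u} [CommRing k] [CharP k p]
  [PerfectRing k p] {X X' : Scheme.{u}} {f : X ⟶ Spec (CommRingCat.of k)}
  {f' : X' ⟶ Spec (CommRingCat.of (TruncatedWittVector p n k))} [Smooth f'] {i : X ⟶ X'}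
  (hi : IsPullback i f f' (Spec.map (CommRingCat.ofHom
    (TruncatedWittVector.firstCoeff : TruncatedWittVector p n k →+* k))))

include hi

theorem isFlatLift_of_isPullback : IsFlatLift p n i where
  isFlatThickening {U} hU := by
    let : Algebra (TruncatedWittVector p n k) k := TruncatedWittVector.firstCoeff.toAlgebra
    let : Algebra (TruncatedWittVector p n k) Γ(X', U) := (algMap f' U).toAlgebra
    let : Algebra k Γ(X, i ⁻¹ᵁ U) := (algMap f (i ⁻¹ᵁ U)).toAlgebra
    let : Algebra Γ(X', U) Γ(X, i ⁻¹ᵁ U) := (i.app U).hom.toAlgebra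
    let : Algebra (TruncatedWittVector p n k) Γ(X, i ⁻¹ᵁ U) :=
      ((algMap f (i ⁻¹ᵁ U)).comp TruncatedWittVector.firstCoeff).toAlgebra
    have : IsScalarTower (TruncatedWittVector p n k) k Γ(X, i ⁻¹ᵁ U) :=
      IsScalarTower.of_algebraMap_eq fun _ => rfl
    have : IsScalarTower (TruncatedWittVector p n k) Γ(X', U) Γ(X, i ⁻¹ᵁ U) :=
      IsScalarTower.of_algebraMap_eq fun a => (app_algMap _ f f' i hi U a).symm
    have : Algebra.IsPushout (TruncatedWittVector p n k) k Γ(X', U) Γ(X, i ⁻¹ᵁ U) :=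
      CommRingCat.isPushout_iff_isPushout.1 (isPushout_algMap _ f f' i hi hU)
    have : Module.Flat (TruncatedWittVector p n k) Γ(X', U) := (smooth_algMap f' hU).flat
    exact (TruncatedWittVector.isFlatThickening_firstCoeff p n k).baseChange

omit [Smooth f'] in
theorem exists_eq_ghostSum_section {U : X'.Opens} (hU : IsAffineOpen U)
    (hst : (algMap f' U).IsStandardSmooth) :
    (∀ y : ℕ → Γ(X', U), ghostSum p n y = 0 → ∀ m < n, i.app U (y m) = 0) ∧
      ∀ s, IsClosedSection f' U s → ∃ y, s = ghostSum p n y := by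
  let : Algebra (TruncatedWittVector p n k) k := TruncatedWittVector.firstCoeff.toAlgebra
  let : Algebra (TruncatedWittVector p n k) Γ(X', U) := (algMap f' U).toAlgebra
  let : Algebra k Γ(X, i ⁻¹ᵁ U) := (algMap f (i ⁻¹ᵁ U)).toAlgebra
  let : Algebra Γ(X', U) Γ(X, i ⁻¹ᵁ U) := (i.app U).hom.toAlgebra
  let : Algebra (TruncatedWittVector p n k) Γ(X, i ⁻¹ᵁ U) :=
    ((algMap f (i ⁻¹ᵁ U)).comp TruncatedWittVector.firstCoeff).toAlgebra
  have : IsScalarTower (TruncatedWittVector p n k) k Γ(X, i ⁻¹ᵁ U) :=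
    IsScalarTower.of_algebraMap_eq fun _ => rfl
  have : IsScalarTower (TruncatedWittVector p n k) Γ(X', U) Γ(X, i ⁻¹ᵁ U) :=
    IsScalarTower.of_algebraMap_eq fun a => (app_algMap _ f f' i hi U a).symm
  have : Algebra.IsPushout (TruncatedWittVector p n k) k Γ(X', U) Γ(X, i ⁻¹ᵁ U) :=
    CommRingCat.isPushout_iff_isPushout.1 (isPushout_algMap _ f f' i hi hU)
  have : Algebra.IsStandardSmooth (TruncatedWittVector p n k) Γ(X', U) := hst
  exact exists_eq_ghostSum_of_isStandardSmooth p n (TruncatedWittVector p n k) k Γ(X', U)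
    Γ(X, i ⁻¹ᵁ U) (TruncatedWittVector.isFlatThickening_firstCoeff p n k)

theorem ghost_map_algMap (U : X'.Opens) (a : TruncatedWittVector p n k) :
    (isFlatLift_of_isPullback hi).ghost (TruncatedWittVector.map (algMap f (i ⁻¹ᵁ U)) a) =
      algMap f' U ((TruncatedWittVector.frobeniusMap p n k)^[n] a) := by
  rw [TruncatedWittVector.iterate_frobeniusMap_eq_sum, map_sum,
    (isFlatLift_of_isPullback hi).ghost_eq_sum (y := fun j => algMap f' U
      (WittVector.truncate n (WittVector.teichmuller p (a.coeff j))))]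
  · simp only [map_mul, map_pow, map_natCast]
  · intro j
    rw [app_algMap _ f f' i hi, TruncatedWittVector.firstCoeff_truncate_teichmuller,
      TruncatedWittVector.coeff_map]

theorem ghostHom_injective (U : X'.Opens) :
    Function.Injective ((isFlatLift_of_isPullback hi).ghostHom U) := by
  have hL := isFlatLift_of_isPullback hi
  rw [injective_iff_map_eq_zero]
  intro x hx
  have hx : hL.ghost x = 0 := hx
  ext j
  rw [TruncatedWittVector.coeff_zero]
  refine Scheme.eq_of_res_eq fun a ha => ?_
  obtain ⟨V, hV, haV, hVU, hst⟩ := exists_isStandardSmooth_algMap f' (show i a ∈ U from ha)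
  obtain ⟨z, hz⟩ := hL.exists_wittReduction_eq hV (wittRes i hVU x)
  refine ⟨i ⁻¹ᵁ V, i.preimage_mono hVU, haV, ?_⟩
  have h1 := hL.res_ghost_eq hVU hz
  rw [hx, map_zero, ← ghostSum_coeff (hL.cast_pow_eq_zero V)] at h1
  have h2 := (exists_eq_ghostSum_section hi hV hst).1 _ h1.symm j j.2
  rw [← coeff_wittReduction, hz] at h2
  rw [map_zero]
  exact h2

theorem range_ghostHom (U : X'.Opens) :
    Set.range ((isFlatLift_of_isPullback hi).ghostHom U) = {s | deRhamD f' U s = 0} := by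
  have hL := isFlatLift_of_isPullback hi
  ext s
  rw [Set.mem_ofPred_eq, deRhamD_eq_zero_iff]
  constructor
  · rintro ⟨x, rfl⟩ a ha
    obtain ⟨V, hV, haV, hVU⟩ := Scheme.exists_isAffineOpen_mem_le ha
    obtain ⟨z, hz⟩ := hL.exists_wittReduction_eq hV (wittRes i hVU x)
    refine ⟨V, hVU, haV, ?_⟩
    have h1 : Scheme.res hVU (hL.ghostHom U x) = _ := hL.res_ghost_eq hVU hz
    rw [h1, ← ghostSum_coeff (hL.cast_pow_eq_zero V)]
    let : Algebra (TruncatedWittVector p n k) Γ(X', V) := (algMap f' V).toAlgebra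
    exact apply_ghostSum_eq_zero (hL.cast_pow_eq_zero V)
      ((KaehlerDifferential.D (TruncatedWittVector p n k) Γ(X', V)).restrictScalars ℤ) _
  · intro h
    have hloc : ∀ a : U, ∃ (V : X'.Opens) (hVU : V ≤ U) (x : TruncatedWittVector p n Γ(X, i ⁻¹ᵁ V)),
        a.1 ∈ V ∧ hL.ghostHom V x = Scheme.res hVU s := by
      rintro ⟨a, ha⟩
      obtain ⟨W, hWU, haW, hW⟩ := h a ha
      obtain ⟨V, hV, haV, hVW, hst⟩ := exists_isStandardSmooth_algMap f' haW
      obtain ⟨y, hy⟩ := (exists_eq_ghostSum_section hi hV hst).2 _ (hW.res f' hVW)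
      refine ⟨V, hVW.trans hWU, wittReduction p n i V (WittVector.mk p y), haV, ?_⟩
      rw [← Scheme.res_res hWU hVW, hy]
      exact (hL.ghost_wittReduction _).trans (ghostSum_coeff (hL.cast_pow_eq_zero V) _).symm
    choose V hVU x haV hx using hloc
    have hglue : ∀ j : Fin n, ∃ t : Γ(X, i ⁻¹ᵁ U), ∀ a : U,
        Scheme.res (i.preimage_mono (hVU a)) t = (x a).coeff j := by
      intro j
      have hcov : ∀ b ∈ i ⁻¹ᵁ U, ∃ a : U, b ∈ i ⁻¹ᵁ (V a) := fun b hb => ⟨⟨i b, hb⟩, haV ⟨i b, hb⟩⟩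
      refine Scheme.exists_res_eq (fun a => i.preimage_mono (hVU a)) hcov
        (fun a => (x a).coeff j) fun a b => ?_
      -- Local preimages of `s` agree on overlaps by injectivity, hence glue component by component.
      have h1 : wittRes i (inf_le_left : V a ⊓ V b ≤ V a) (x a) =
          wittRes i (inf_le_right : V a ⊓ V b ≤ V b) (x b) := by
        refine ghostHom_injective hi _ ?_
        have h2 : ∀ {W W' : X'.Opens} (hW : W' ≤ W) (w : TruncatedWittVector p n Γ(X, i ⁻¹ᵁ W)),
            hL.ghostHom W' (wittRes i hW w) = Scheme.res hW (hL.ghostHom W w) :=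
          fun hW w => (hL.res_ghost hW w).symm
        rw [h2, h2, hx, hx, Scheme.res_res, Scheme.res_res]
      exact congrArg (TruncatedWittVector.coeff j) h1
    choose t ht using hglue
    refine ⟨TruncatedWittVector.mk p t, Scheme.eq_of_res_eq fun a ha => ⟨V ⟨a, ha⟩, hVU _, haV _, ?_⟩⟩
    rw [← hx]
    refine (hL.res_ghost _ _).trans (congrArg hL.ghost ?_)
    ext j
    exact ht j ⟨a, ha⟩

end Main

end AlgebraicGeometry

end

theorem mainTheorem7 (p : ℕ) [Fact p.Prime] (n : ℕ) [NeZero n]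
    (k : Type u) [CommRing k] [CharP k p] [PerfectRing k p]
    {X X' : Scheme.{u}} (f : X ⟶ Spec (CommRingCat.of k)) [Smooth f]
    (f' : X' ⟶ Spec (CommRingCat.of (TruncatedWittVector p n k))) [Smooth f']
    (i : X ⟶ X')
    (hi : IsPullback i f f' (Spec.map (CommRingCat.ofHom
      (TruncatedWittVector.firstCoeff : TruncatedWittVector p n k →+* k)))) :
    IsHomeomorph i ∧
    (∃! φ, IsTildeF p n i φ) ∧
    ∃ F : wittSheafOn p n i ⟶ X'.sheaf,
      IsTildeF p n i (Functor.whiskerRight F.hom (forget CommRingCat.{u})) ∧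
      ∀ U : X'.Opens,
        (∀ (a : TruncatedWittVector p n k) (x : TruncatedWittVector p n Γ(X, i ⁻¹ᵁ U)),
          onSections F U (TruncatedWittVector.map (algMap f (i ⁻¹ᵁ U)) a * x) =
            algMap f' U ((TruncatedWittVector.frobeniusMap p n k)^[n] a) * onSections F U x) ∧
        Function.Injective (onSections F U) ∧
        Set.range (onSections F U) = {s : Γ(X', U) | deRhamD f' U s = 0} := by
  have hA := TruncatedWittVector.isFlatThickening_firstCoeff p n k
  have hL := isFlatLift_of_isPullback hi
  refine ⟨isHomeomorph_of_isPullback hA.surjective (fun a ha => ?_) hi,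
    hL.existsUnique_isTildeF, hL.ghostSheafHom, hL.isTildeF_ghostSheafHom, fun U => ?_⟩
  · obtain ⟨c, rfl⟩ := (hA.map_eq_zero_iff a).1 ha
    exact ⟨n, by rw [mul_pow, hA.pow_eq_zero, zero_mul]⟩
  · rw [hL.onSections_ghostSheafHom]
    refine ⟨fun a x => ?_, ghostHom_injective hi U, range_ghostHom hi U⟩
    rw [map_mul]
    exact congrArg (· * hL.ghostHom U x) (ghost_map_algMap hi U a)
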